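/- Let $p$ be a prime, $\omega=e^{2\pi i/p}$, and let $\sigma$ be a generator of $\mathrm{Gal}(\mathbb{Q}(\omega)/\mathbb{Q})$, with $\omega^\sigma=\omega^b$, $b\in\{1,\dots,p-1\}$. Let $\tau$ be the permutation of $\{0,1,\dots,p\}$ that fixes $0$ and $p$ and sends $x\in\{1,\dots,p-1\}$ to the element of $\{1,\dots,p-1\}$ congruent to $bx$ modulo $p$. For $k\ge 0$ let $P_{p^k}$ be the Sylow $p$-subgroup of the symmetric group on $\{1,\dots,p^k\}$ generated by the permutations $g_i=\prod_{j=1}^{p^{i-1}}(j,\,p^{i-1}+j,\,2p^{i-1}+j,\,\dots,\,(p-1)p^{i-1}+j)$ for $1\le i\le k$. Dividing the $p^{k}$ letters into $p$ consecutive blocks identifies $P_{p^{k}}$, for $k\ge 1$, with the wreath product $P_{p^{k-1}}\wr C_p$, where $C_p=\langle\gamma\rangle$ and $\gamma=(1,\dots,p)$. Let $\phi_\varepsilon$ be the linear character of $C_p$ with $\phi_\varepsilon(\gamma)=\omega^\varepsilon$, $0\le\varepsilon\le p-1$. Every $\theta\in\mathrm{Irr}(P_{p^k})$, $k\ge1$,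 is either of the form $\mathcal{X}(\phi;\varepsilon)$ with $\phi\in\mathrm{Irr}(P_{p^{k-1}})$ and $0\le\varepsilon\le p-1$ (the canonical extension of $\phi\times\dots\times\phi$ to the wreath product, afforded by the $p$-th tensor power of a module affording $\phi$, times the inflation of $\phi_\varepsilon$), or induced from a character $\theta_1\times\dots\times\theta_p$ of the base group with $\theta_i\in\mathrm{Irr}(P_{p^{k-1}})$ not all equal. For $k\geq 1$ the skeleton $\mathcal{S}_{p^k}$ is the set of sequences of length at most $k-1$ with entries in $\{1,\dots,p\}$ (the vertices of the complete $p$-ary rooted tree of height $k-1$). A labelling function is a map $t:\mathcal{S}_{p^k}\to\{0,\dots,p\}$; two labelling functions are equivalent if one is obtained from the other by cyclically reordering, independently at each vertex, the $p$ subtrees below it; a tree function is an equivalence class. It is admissible if for a representative $t$ no sequence of length $k-1$ has label $p$ and, for every $\mathtt{s}$ of length less than $k-1$, the tree functions given by the $p$ subtrees rooted at $\mathtt{s}1,\dots,\mathtt{s}p$ are all equal if $t(\mathtt{s})\ne p$ and not all equal if $t(\mathtt{s})=p$. To $\theta\in\mathrm{Irr}(P_{p^k})$ one attaches recursively a tree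 function $\mathcal{T}(\theta)$: for $k=1$, $\mathcal{T}(\phi_\varepsilon)$ is the single vertex with label $\varepsilon$; for $k>1$, $\mathcal{T}(\mathcal{X}(\phi;\varepsilon))$ has root label $\varepsilon$ and all $p$ subtrees given by $\mathcal{T}(\phi)$, and if $\theta$ is induced from $\theta_1\times\dots\times\theta_p$ as above, then $\mathcal{T}(\theta)$ has root label $p$ and subtrees given by $\mathcal{T}(\theta_1),\dots,\mathcal{T}(\theta_p)$, in this order. Let $k\ge 1$ and $\theta\in\mathrm{Irr}(P_{p^k})$. Then $\mathcal{T}(\theta)$ is admissible, $\theta$ has values in $\mathbb{Q}(\omega)$, the function $\theta^\sigma$ with $\theta^\sigma(g)=(\theta(g))^\sigma$ is again an irreducible character of $P_{p^k}$, and $\mathcal{T}^\sigma:=\mathcal{T}(\theta^\sigma)$ is obtained from $\mathcal{T}:=\mathcal{T}(\theta)$ by applying $\tau$ to every label: $$\mathcal{T}^\sigma(\mathtt{s})=(\mathcal{T}(\mathtt{s}))\tau\quad\text{for all }\mathtt{s}\in\mathcal{S}_{p^k},$$ that is, if $t$ is any labelling function that represents $\mathcal{T}(\theta)$, then $\mathtt{s}\mapsto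 (t(\mathtt{s}))\tau$ represents $\mathcal{T}(\theta^\sigma)$. -/

import Mathlib

namespace SylowTree

open Equiv IntermediateField
open scoped TensorProduct

/-! ### Cyclic groups, wreath products and the Sylow subgroup of degree `p ^ k` -/

/-- The cyclic group generated by the `p`-cycle `γ`. The letters `1, …, p` are represented by the
elements `0, …, p - 1` of `Fin p`, so that `γ` is `i ↦ i + 1` (modulo `p`). -/
abbrev Cyc (p : ℕ) : Subgroup (Perm (Fin p)) := Subgroup.zpowers (finRotate p)

/-- The wreath product of `G` by the cyclic group `Cyc p`, with base group `Fin p → G`;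
`(f; δ) (f'; δ') = (i ↦ f i * f' (δ⁻¹ i); δ δ')`. -/
abbrev Wr (p : ℕ) (G : Type) [Group G] : Type :=
  (Fin p → G) ⋊[(mulAutArrow : Cyc p →* MulAut (Fin p → G))] (Cyc p)

theorem wr_mul_left {p : ℕ} {G : Type} [Group G] (x y : Wr p G) (i : Fin p) :
    (x * y).left i = x.left i * y.left ((x.right : Perm (Fin p))⁻¹ i) := rfl

/-- The underlying map of the `(i + 1)`-st generator: on `{0, …, p ^ k - 1}` it is the product of
the `p ^ i` cycles `(j, p ^ i + j, 2 p ^ i + j, …, (p - 1) p ^ i + j)`, for `0 ≤ j < p ^ i`. -/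
def genFun (p i x : ℕ) : ℕ := if x < p ^ (i + 1) then (x + p ^ i) % p ^ (i + 1) else x

theorem genFun_lt {p k i x : ℕ} (hp : 0 < p) (hi : i < k) (hx : x < p ^ k) :
    genFun p i x < p ^ k := by
  unfold genFun
  split_ifs with h
  · exact (Nat.mod_lt _ (Nat.pow_pos hp)).trans_le (Nat.pow_le_pow_right hp hi)
  · exact hx

theorem genFun_inj {p i x y : ℕ} (hp : 0 < p) (h : genFun p i x = genFun p i y) : x = y := by
  have hpos : 0 < p ^ (i + 1) := Nat.pow_pos hp
  unfold genFun at h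
  split_ifs at h with hx hy hy
  · have h2 : x ≡ y [MOD p ^ (i + 1)] := Nat.ModEq.add_right_cancel' (p ^ i) h
    exact Nat.ModEq.eq_of_lt_of_lt h2 hx hy
  · exact absurd (h ▸ Nat.mod_lt _ hpos) hy
  · exact absurd (h ▸ Nat.mod_lt _ hpos) hx
  · exact h

/-- The generator of index `i + 1`, as a permutation of `p ^ k` letters. -/
noncomputable def gen (p k : ℕ) [Fact p.Prime] (i : Fin k) : Perm (Fin (p ^ k)) :=
  Equiv.ofBijective
    (fun x => ⟨genFun p i x, genFun_lt (Fact.out : p.Prime).pos i.2 x.2⟩)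
    (Finite.injective_iff_bijective.1 fun _ _ h =>
      Fin.ext (genFun_inj (Fact.out : p.Prime).pos (congrArg Fin.val h)))

/-- The Sylow `p`-subgroup `P_{p^k}` of the symmetric group on `p ^ k` letters, given by its `k`
standard generators. -/
def P (p k : ℕ) [Fact p.Prime] : Subgroup (Perm (Fin (p ^ k))) :=
  Subgroup.closure (Set.range (gen p k))

/-- `p ^ (k + 1)` letters as `p` consecutive blocks of `p ^ k` letters:
`(i, y) ↦ y + p ^ k * i`. -/
def blocks (p k : ℕ) : Fin p × Fin (p ^ k) ≃ Fin (p ^ (k + 1)) :=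
  finProdFinEquiv.trans (finCongr (pow_succ' p k).symm)

/-- The permutation `(i, y) ↦ (δ i, f_{δ i} y)` attached to `(f; δ)`. -/
def pairPerm (p k : ℕ) [Fact p.Prime] (w : Wr p (P p k)) : Perm (Fin p × Fin (p ^ k)) where
  toFun z := ((w.right : Perm (Fin p)) z.1,
    (w.left ((w.right : Perm (Fin p)) z.1) : Perm (Fin (p ^ k))) z.2)
  invFun z := ((w.right : Perm (Fin p))⁻¹ z.1, (w.left z.1 : Perm (Fin (p ^ k)))⁻¹ z.2)
  left_inv z := by ext <;> simp
  right_inv z := by ext <;> simp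

/-- The canonical permutation representation of the wreath product of `P_{p^k}` by `Cyc p`. -/
def wrPerm (p k : ℕ) [Fact p.Prime] : Wr p (P p k) →* Perm (Fin (p ^ (k + 1))) where
  toFun w := (blocks p k).permCongr (pairPerm p k w)
  map_one' := by
    ext x
    simp [pairPerm, Equiv.permCongr_apply]
  map_mul' v w := by
    ext x
    simp [pairPerm, Equiv.permCongr_apply, wr_mul_left]

theorem wrPerm_blocks (p k : ℕ) [Fact p.Prime] (w : Wr p (P p k)) (i : Fin p)
    (y : Fin (p ^ k)) :
    wrPerm p k w (blocks p k (i, y)) = blocks p k ((w.right : Perm (Fin p)) i,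
      (w.left ((w.right : Perm (Fin p)) i) : Perm (Fin (p ^ k))) y) := by
  simp [wrPerm, pairPerm, Equiv.permCongr_apply]

theorem blocks_val (p k : ℕ) (i : Fin p) (y : Fin (p ^ k)) :
    (blocks p k (i, y) : ℕ) = y + p ^ k * i := by
  simp [blocks]

theorem wrPerm_injective (p k : ℕ) [Fact p.Prime] : Function.Injective (wrPerm p k) := by
  intro v w h
  have hpos : 0 < p ^ k := Nat.pow_pos (Fact.out : p.Prime).pos
  have key : ∀ i y, ((v.right : Perm (Fin p)) i,
      (v.left ((v.right : Perm (Fin p)) i) : Perm (Fin (p ^ k))) y) =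
      ((w.right : Perm (Fin p)) i,
      (w.left ((w.right : Perm (Fin p)) i) : Perm (Fin (p ^ k))) y) := by
    intro i y
    apply (blocks p k).injective
    rw [← wrPerm_blocks, ← wrPerm_blocks, h]
  have hr : v.right = w.right := by
    apply Subtype.ext
    ext i
    exact congrArg Fin.val (Prod.ext_iff.1 (key i ⟨0, hpos⟩)).1
  apply SemidirectProduct.ext _ hr
  funext j
  apply Subtype.ext
  ext y
  have := (Prod.ext_iff.1 (key ((v.right : Perm (Fin p))⁻¹ j) y)).2
  rw [← hr] at this
  simpa using congrArg Fin.val this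

/-- The element `γ` of `Cyc p`. -/
def rot (p : ℕ) : Cyc p := ⟨finRotate p, Subgroup.mem_zpowers _⟩

theorem rot_val (p : ℕ) (i : Fin p) :
    (((rot p : Cyc p) : Perm (Fin p)) i : ℕ) = (i + 1) % p := by
  have := i.neZero
  rw [show ((rot p : Cyc p) : Perm (Fin p)) = finRotate p from rfl, finRotate_apply]
  rw [Fin.val_add]
  simp

theorem wrPerm_rot (p k : ℕ) [Fact p.Prime] :
    wrPerm p k (SemidirectProduct.inr (rot p)) = gen p (k + 1) (Fin.last k) := by
  have hp := (Fact.out : p.Prime).pos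
  ext x
  obtain ⟨⟨i, y⟩, rfl⟩ := (blocks p k).surjective x
  rw [wrPerm_blocks, blocks_val]
  simp only [SemidirectProduct.right_inr, SemidirectProduct.left_inr, Pi.one_apply,
    Subgroup.coe_one, Perm.one_apply, rot_val]
  change _ = genFun p k (blocks p k (i, y))
  have hlt := (blocks p k (i, y)).2
  rw [genFun, if_pos hlt, blocks_val, pow_succ]
  rw [show (y : ℕ) + p ^ k * i + p ^ k = y + p ^ k * (i + 1) by ring, Nat.mod_mul]
  congr 1
  · rw [Nat.add_mul_mod_self_left, Nat.mod_eq_of_lt y.2]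
  · rw [Nat.add_mul_div_left _ _ (Nat.pow_pos hp), Nat.div_eq_of_lt y.2, zero_add]

theorem wrPerm_single (p k : ℕ) [Fact p.Prime] (j : Fin k) :
    wrPerm p k (SemidirectProduct.inl (Pi.mulSingle ⟨0, (Fact.out : p.Prime).pos⟩
      (⟨gen p k j, Subgroup.subset_closure ⟨j, rfl⟩⟩ : P p k))) =
      gen p (k + 1) j.castSucc := by
  have hp := (Fact.out : p.Prime).pos
  ext x
  obtain ⟨⟨i, y⟩, rfl⟩ := (blocks p k).surjective x
  rw [wrPerm_blocks, blocks_val]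
  simp only [SemidirectProduct.right_inl, SemidirectProduct.left_inl, Subgroup.coe_one,
    Perm.one_apply]
  change _ = genFun p j (blocks p k (i, y))
  rw [blocks_val]
  by_cases hi : i = ⟨0, hp⟩
  · subst hi
    rw [Pi.mulSingle_eq_same]
    simp only [mul_zero, add_zero]
    rfl
  · rw [Pi.mulSingle_eq_of_ne hi]
    have h1 : 1 ≤ (i : ℕ) := Nat.one_le_iff_ne_zero.2 fun h => hi (Fin.ext h)
    have h2 : p ^ ((j : ℕ) + 1) ≤ p ^ k := Nat.pow_le_pow_right hp j.2
    have h3 : p ^ k * 1 ≤ p ^ k * i := Nat.mul_le_mul_left _ h1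
    rw [genFun, if_neg (by omega)]
    rfl

theorem wr_conj (p : ℕ) (G : Type) [Group G] [DecidableEq (Fin p)] (δ : Cyc p) (i : Fin p)
    (g : G) :
    (SemidirectProduct.inr δ * SemidirectProduct.inl (Pi.mulSingle i g) *
      (SemidirectProduct.inr δ)⁻¹ : Wr p G) =
      SemidirectProduct.inl (Pi.mulSingle ((δ : Perm (Fin p)) i) g) := by
  rw [← map_inv, ← SemidirectProduct.inl_aut]
  congr 1
  funext j
  change (Pi.mulSingle i g : Fin p → G) ((δ : Perm (Fin p))⁻¹ j) = _
  by_cases h : j = (δ : Perm (Fin p)) i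
  · subst h; simp
  · rw [Pi.mulSingle_eq_of_ne h, Pi.mulSingle_eq_of_ne]
    intro h'
    apply h
    rw [← h']
    simp

theorem wrPerm_range (p k : ℕ) [Fact p.Prime] : (wrPerm p k).range = P p (k + 1) := by
  have hp := (Fact.out : p.Prime).pos
  apply le_antisymm
  · -- the base group and the top group both land in the subgroup
    have htop : ∀ δ : Cyc p, wrPerm p k (SemidirectProduct.inr δ) ∈ P p (k + 1) := by
      rintro ⟨δ, n, rfl⟩
      have : (⟨finRotate p ^ n, n, rfl⟩ : Cyc p) = rot p ^ n := rfl
      rw [this, map_zpow, map_zpow, wrPerm_rot]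
      exact Subgroup.zpow_mem _ (Subgroup.subset_closure (Set.mem_range_self _)) n
    have hzero : ∀ g : P p k, wrPerm p k (SemidirectProduct.inl
        (Pi.mulSingle ⟨0, hp⟩ g)) ∈ P p (k + 1) := by
      rintro ⟨g, hg⟩
      refine Subgroup.closure_induction (p := fun (g : Perm (Fin (p ^ k)))
        (hg : g ∈ P p k) => wrPerm p k (SemidirectProduct.inl
        (Pi.mulSingle ⟨0, hp⟩ (⟨g, hg⟩ : P p k))) ∈ P p (k + 1)) ?_ ?_ ?_ ?_ hg
      · rintro _ ⟨j, rfl⟩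
        rw [wrPerm_single]
        exact Subgroup.subset_closure ⟨_, rfl⟩
      · have : (⟨1, Subgroup.one_mem _⟩ : P p k) = 1 := rfl
        rw [this, Pi.mulSingle_one, map_one, map_one]
        exact Subgroup.one_mem _
      · intro x y hx hy h1 h2
        have : (⟨x * y, Subgroup.mul_mem _ hx hy⟩ : P p k) = ⟨x, hx⟩ * ⟨y, hy⟩ := rfl
        rw [this, Pi.mulSingle_mul, map_mul, map_mul]
        exact Subgroup.mul_mem _ h1 h2
      · intro x hx h1
        have : (⟨x⁻¹, Subgroup.inv_mem _ hx⟩ : P p k) = ⟨x, hx⟩⁻¹ := rfl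
        rw [this, Pi.mulSingle_inv, map_inv, map_inv]
        exact Subgroup.inv_mem _ h1
    have hrot : ∀ n : ℕ, ∀ h : n < p,
        ((rot p ^ n : Cyc p) : Perm (Fin p)) ⟨0, hp⟩ = ⟨n, h⟩ := by
      intro n
      induction n with
      | zero => intro h; rfl
      | succ n ih =>
        intro h
        rw [pow_succ', Subgroup.coe_mul, Perm.mul_apply, ih (by omega)]
        apply Fin.ext
        rw [rot_val]
        exact Nat.mod_eq_of_lt h
    have hsingle : ∀ (i : Fin p) (g : P p k), wrPerm p k (SemidirectProduct.inl
        (Pi.mulSingle i g)) ∈ P p (k + 1) := by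
      intro i g
      have h := wr_conj p (P p k) (rot p ^ (i : ℕ)) ⟨0, hp⟩ g
      rw [hrot i i.2] at h
      rw [← h, map_mul, map_mul, map_inv]
      exact Subgroup.mul_mem _ (Subgroup.mul_mem _ (htop _) (hzero g))
        (Subgroup.inv_mem _ (htop _))
    have hbase : ∀ f : Fin p → P p k, wrPerm p k (SemidirectProduct.inl f) ∈ P p (k + 1) := by
      intro f
      have : Subgroup.pi Set.univ (fun _ => ⊤) ≤
          (P p (k + 1)).comap ((wrPerm p k).comp
            (SemidirectProduct.inl : (Fin p → P p k) →* Wr p (P p k))) := by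
        rw [Subgroup.pi_le_iff]
        intro i
        rintro _ ⟨g, -, rfl⟩
        exact hsingle i g
      exact this (by simp [Subgroup.mem_pi])
    rintro _ ⟨w, rfl⟩
    rw [← SemidirectProduct.inl_left_mul_inr_right w, map_mul]
    exact Subgroup.mul_mem _ (hbase _) (htop _)
  · rw [P, Subgroup.closure_le]
    rintro _ ⟨j, rfl⟩
    induction j using Fin.lastCases with
    | last => exact ⟨_, wrPerm_rot p k⟩
    | cast j => exact ⟨_, wrPerm_single p k j⟩

/-- The identification of `P_{p^(k+1)}` with the wreath product of `P_{p^k}` by `Cyc p`. -/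
noncomputable def wrIso (p k : ℕ) [Fact p.Prime] : Wr p (P p k) ≃* P p (k + 1) :=
  (MonoidHom.ofInjective (wrPerm_injective p k)).trans (MulEquiv.subgroupCongr (wrPerm_range p k))

/-! ### Characters -/

/-- `χ` is the character of an irreducible finite-dimensional complex representation of `G`. -/
def IsIrrChar {G : Type} [Group G] (χ : G → ℂ) : Prop :=
  ∃ (V : Type) (_ : AddCommGroup V) (_ : Module ℂ V) (_ : FiniteDimensional ℂ V)
    (ρ : Representation ℂ G V), ρ.IsIrreducible ∧ ρ.character = χ

/-- The primitive root of unity `ω = exp (2 π i / p)`. -/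
noncomputable def zetaP (p : ℕ) : ℂ := Complex.exp (2 * Real.pi * Complex.I / p)

/-- The linear character `φ_ε` of `Cyc p`, with `φ_ε (γ ^ m) = ω ^ (ε m)`. Note that `γ ^ m` is the
element of `Cyc p` that sends the letter `0` of `Fin p` to `m` modulo `p`. -/
noncomputable def phi (p : ℕ) [Fact p.Prime] (ε : Fin p) (δ : Cyc p) : ℂ :=
  zetaP p ^ ((ε : ℕ) * ((δ : Perm (Fin p)) ⟨0, (Fact.out : p.Prime).pos⟩ : ℕ))

/-- The action of the wreath product on the `p`-th tensor power of a representation `V` of `G`: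
`(g_1, …, g_p; h)` maps `v_1 ⊗ ⋯ ⊗ v_p` to `g_1 v_{h⁻¹ 1} ⊗ ⋯ ⊗ g_p v_{h⁻¹ p}`. -/
noncomputable def tensorRep (p : ℕ) {G : Type} [Group G] {V : Type} [AddCommGroup V] [Module ℂ V]
    (ρ : Representation ℂ G V) : Representation ℂ (Wr p G) (⨂[ℂ] _ : Fin p, V) where
  toFun w := PiTensorProduct.map (fun i => ρ (w.left i)) ∘ₗ
    (PiTensorProduct.reindex ℂ (fun _ : Fin p => V) (w.right : Perm (Fin p))).toLinearMap
  map_one' := by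
    apply PiTensorProduct.ext
    ext v
    simp
    rfl
  map_mul' x y := by
    apply PiTensorProduct.ext
    ext v
    simp only [LinearMap.compMultilinearMap_apply, LinearMap.comp_apply, LinearEquiv.coe_coe,
      PiTensorProduct.reindex_tprod, PiTensorProduct.map_tprod, Module.End.mul_apply, wr_mul_left,
      map_mul]
    rfl

theorem tensorRep_tprod (p : ℕ) {G : Type} [Group G] {V : Type} [AddCommGroup V] [Module ℂ V]
    (ρ : Representation ℂ G V) (w : Wr p G) (v : Fin p → V) :
    tensorRep p ρ w (PiTensorProduct.tprod ℂ v) =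
      PiTensorProduct.tprod ℂ (fun i => ρ (w.left i) (v ((w.right : Perm (Fin p))⁻¹ i))) := by
  simp only [tensorRep, MonoidHom.coe_mk, OneHom.coe_mk, LinearMap.comp_apply,
    LinearEquiv.coe_coe, PiTensorProduct.reindex_tprod, PiTensorProduct.map_tprod]
  rfl

/-- `χ` is the character `𝒳(φ; φ_ε)` of the wreath product: the tensor power character built from a
representation affording `φ`, multiplied by the inflation of `φ_ε`. -/
def IsExtChar {p : ℕ} [Fact p.Prime] {G : Type} [Group G] (φ : G → ℂ) (ε : Fin p)
    (χ : Wr p G → ℂ) : Prop :=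
  ∃ (V : Type) (_ : AddCommGroup V) (_ : Module ℂ V) (_ : FiniteDimensional ℂ V)
    (ρ : Representation ℂ G V), ρ.character = φ ∧
      ∀ w : Wr p G, χ w = (tensorRep p ρ).character w * phi p ε w.right

open Classical in
/-- The class function of `G` induced from a class function of the subgroup `H`. -/
noncomputable def indChar {G : Type} [Group G] (H : Subgroup G) (χ : H → ℂ) (g : G) : ℂ :=
  (Nat.card H : ℂ)⁻¹ * ∑ᶠ x : G, if h : x⁻¹ * g * x ∈ H then χ ⟨x⁻¹ * g * x, h⟩ else 0

/-- The base group of the wreath product, as a subgroup. -/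
def baseGroup (p : ℕ) (G : Type) [Group G] : Subgroup (Wr p G) :=
  (SemidirectProduct.inl : (Fin p → G) →* Wr p G).range

/-- The character of the wreath product induced from the character `θ_1 × ⋯ × θ_p` of the base
group. -/
noncomputable def indProd {p : ℕ} {G : Type} [Group G] (θ : Fin p → G → ℂ) : Wr p G → ℂ :=
  indChar (baseGroup p G) fun h => ∏ i, θ i ((h : Wr p G).left i)

/-- The field `ℚ(ω)`. -/
noncomputable abbrev CycField (p : ℕ) : IntermediateField ℚ ℂ := ℚ⟮zetaP p⟯

open Classical in
/-- The Galois conjugate `θ ^ σ` of a function `θ` with values in `ℚ(ω)`: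
`θ ^ σ (g) = (θ (g)) ^ σ`. (Values outside `ℚ(ω)` are sent to `0`.) -/
noncomputable def galConj {p : ℕ} {G : Type} (σ : CycField p ≃ₐ[ℚ] CycField p) (θ : G → ℂ) :
    G → ℂ :=
  fun g => if h : θ g ∈ CycField p then ((σ ⟨θ g, h⟩ : CycField p) : ℂ) else 0

/-! ### Labelling functions and tree functions -/

/-- The skeleton: sequences of length at most `k - 1` with `p` symbols; the symbols `1, …, p` are
represented by the elements of `Fin p`. -/
abbrev Skel (p k : ℕ) : Type := {s : List (Fin p) // s.length < k}

/-- Labelling functions, with labels in `{0, …, p}`. -/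
abbrev Labelling (p k : ℕ) : Type := Skel p k → Fin (p + 1)

/-- `s_1 ⋯ s_l ↦ γ_∅(s_1) γ_{s_1}(s_2) ⋯ γ_{s_1 ⋯ s_{l-1}}(s_l)`. -/
def twist {p : ℕ} (γ : List (Fin p) → Perm (Fin p)) : List (Fin p) → List (Fin p)
  | [] => []
  | x :: s => γ [] x :: twist (fun q => γ (x :: q)) s

theorem twist_length {p : ℕ} (γ : List (Fin p) → Perm (Fin p)) (s : List (Fin p)) :
    (twist γ s).length = s.length := by
  induction s generalizing γ with
  | nil => rfl
  | cons x s ih => simp [twist, ih]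

theorem twist_one {p : ℕ} (s : List (Fin p)) : twist (fun _ => 1) s = s := by
  induction s with
  | nil => rfl
  | cons x s ih => simp [twist, ih]

theorem twist_twist {p : ℕ} (γ γ' : List (Fin p) → Perm (Fin p)) (s : List (Fin p)) :
    twist γ' (twist γ s) = twist (fun q => γ' (twist γ q) * γ q) s := by
  induction s generalizing γ γ' with
  | nil => rfl
  | cons x s ih => simp [twist, ih]

/-- The inverse map of `twist γ`. -/
def untwist {p : ℕ} (γ : List (Fin p) → Perm (Fin p)) : List (Fin p) → List (Fin p)
  | [] => []
  | x :: s => (γ [])⁻¹ x :: untwist (fun q => γ ((γ [])⁻¹ x :: q)) s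

theorem twist_untwist {p : ℕ} (γ : List (Fin p) → Perm (Fin p)) (s : List (Fin p)) :
    twist γ (untwist γ s) = s := by
  induction s generalizing γ with
  | nil => rfl
  | cons x s ih => simp [twist, untwist, ih]

theorem twist_inv {p : ℕ} (γ : List (Fin p) → Perm (Fin p)) (s : List (Fin p)) :
    twist (fun q => (γ (untwist γ q))⁻¹) s = untwist γ s := by
  induction s generalizing γ with
  | nil => rfl
  | cons x s ih => exact congrArg (List.cons _) (ih fun q => γ ((γ [])⁻¹ x :: q))

/-- Application of `twist γ` to a vertex of the skeleton. -/
def twistSkel {p k : ℕ} (γ : List (Fin p) → Perm (Fin p)) (s : Skel p k) : Skel p k :=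
  ⟨twist γ s.1, by rw [twist_length]; exact s.2⟩

/-- Equivalence of labelling functions: they differ by cyclic reorderings, one for every vertex, of
the subtrees below that vertex. (The empty sequence is fixed by `twist`, so the two root labels
agree.) -/
def LabEquiv {p k : ℕ} (t₁ t₂ : Labelling p k) : Prop :=
  ∃ γ : List (Fin p) → Perm (Fin p), (∀ q, γ q ∈ Cyc p) ∧ ∀ s, t₁ s = t₂ (twistSkel γ s)

instance labSetoid (p k : ℕ) : Setoid (Labelling p k) where
  r := LabEquiv
  iseqv := {
    refl := fun t => ⟨fun _ => 1, fun _ => Subgroup.one_mem _, fun s => by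
      congr 1; exact Subtype.ext (twist_one s.1).symm⟩
    symm := by
      rintro t₁ t₂ ⟨γ, hγ, h⟩
      refine ⟨fun q => (γ (untwist γ q))⁻¹, fun q => Subgroup.inv_mem _ (hγ _), fun s => ?_⟩
      rw [h]
      congr 1
      apply Subtype.ext
      change s.1 = twist γ (twist _ s.1)
      rw [twist_inv, twist_untwist]
    trans := by
      rintro t₁ t₂ t₃ ⟨γ, hγ, h⟩ ⟨γ', hγ', h'⟩
      refine ⟨fun q => γ' (twist γ q) * γ q, fun q => Subgroup.mul_mem _ (hγ' _) (hγ _),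
        fun s => ?_⟩
      rw [h, h']
      congr 1
      exact Subtype.ext (twist_twist γ γ' s.1) }

/-- Tree functions: equivalence classes of labelling functions. -/
abbrev TreeFun (p k : ℕ) : Type := Quotient (labSetoid p k)

/-- The root of the skeleton. -/
def root (p k : ℕ) : Skel p (k + 1) := ⟨[], by simp⟩

/-- The labelling subfunction rooted at the vertex `i` of length one. -/
def sub {p k : ℕ} (t : Labelling p (k + 1)) (i : Fin p) : Labelling p k :=
  fun s => t ⟨i :: s.1, by simpa using s.2⟩

/-- The labelling function `(f_1 | ⋯ | f_p; x)`. -/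
def join {p k : ℕ} (f : Fin p → Labelling p k) (x : Fin (p + 1)) : Labelling p (k + 1)
  | ⟨[], _⟩ => x
  | ⟨i :: s, h⟩ => f i ⟨s, by simpa using h⟩

/-- The tree function `(F_1 | ⋯ | F_p; x)`. -/
noncomputable def treeJoin {p k : ℕ} (F : Fin p → TreeFun p k) (x : Fin (p + 1)) :
    TreeFun p (k + 1) :=
  ⟦join (fun i => (F i).out) x⟧

/-- Admissibility of labelling functions (only meant for `k ≥ 1`): leaves are not labelled `p`; all
subfunctions are admissible; the subfunctions below an inner vertex represent the same tree function
if the vertex has a label in `{0, …, p - 1}`, and not all the same one if its label is `p`. -/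
def IsAdmissible {p : ℕ} : (k : ℕ) → Labelling p k → Prop
  | 0, _ => True
  | 1, t => t (root p 0) ≠ Fin.last p
  | k + 2, t =>
      (∀ i, IsAdmissible (k + 1) (sub t i)) ∧
      (t (root p (k + 1)) ≠ Fin.last p →
        ∀ i j, (⟦sub t i⟧ : TreeFun p (k + 1)) = ⟦sub t j⟧) ∧
      (t (root p (k + 1)) = Fin.last p →
        ∃ i j, (⟦sub t i⟧ : TreeFun p (k + 1)) ≠ ⟦sub t j⟧)

/-! ### The tree function of an irreducible character -/

/-- `θ = 𝒳(φ; φ_ε)`, with `φ` an irreducible character of `P_{p^k}`. -/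
def CaseExt {p k : ℕ} [Fact p.Prime] (θ : P p (k + 1) → ℂ) (d : (P p k → ℂ) × Fin p) : Prop :=
  IsIrrChar d.1 ∧ IsExtChar d.1 d.2 fun w => θ (wrIso p k w)

/-- `θ` is induced from `θ_1 × ⋯ × θ_p`, with `θ_i` irreducible characters of `P_{p^k}` that are not
all equal. -/
def CaseInd {p k : ℕ} [Fact p.Prime] (θ : P p (k + 1) → ℂ) (d : Fin p → P p k → ℂ) : Prop :=
  (∀ i, IsIrrChar (d i)) ∧ (∃ i j, d i ≠ d j) ∧ (fun w => θ (wrIso p k w)) = indProd d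

open Classical in
/-- The tree function of an irreducible character `θ` of `P_{p^k}`, by recursion on `k`. The
recursion starts at the trivial group `P_{p^0}`, whose skeleton is empty; for the cyclic group
`P_{p^1}` it attaches to `φ_ε` the single vertex with label `ε`. Functions that are of neither form
get the constant label `p`, which is not admissible. -/
noncomputable def treeOf {p : ℕ} [Fact p.Prime] : (k : ℕ) → (P p k → ℂ) → TreeFun p k
  | 0, _ => ⟦fun _ => Fin.last p⟧
  | k + 1, θ =>
      if h : ∃ d, CaseExt θ d then
        treeJoin (fun _ => treeOf k h.choose.1) h.choose.2.castSucc
      else if h : ∃ d, CaseInd θ d then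
        treeJoin (fun i => treeOf k (h.choose i)) (Fin.last p)
      else ⟦fun _ => Fin.last p⟧

/-- The permutation `τ` of the labels `{0, …, p}`: it fixes `0` and `p`, and sends a label
`x ∈ {1, …, p - 1}` to the residue of `b x` modulo `p`. -/
def tau (p b : ℕ) (x : Fin (p + 1)) : Fin (p + 1) :=
  if x = Fin.last p then Fin.last p else Fin.ofNat (p + 1) (b * x % p)

end SylowTree

open SylowTree

namespace SylowTree

open Equiv IntermediateField
open scoped TensorProduct

/-! ### Irreducible characters of finite groups -/

section Characters

variable {G : Type} [Group G] [Fintype G]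

/-! The proof is an induction on `k` along `P_{p^(k+1)} = P_{p^k} ≀ C_p`, and `θ^σ` is built rather
than shown irreducible abstractly. Values of the canonical extension of `φ` are products of values
of `φ`, values of an induced character are sums of products of values of the `θ_i`, and `φ_ε` takes
powers of `ω`. Applying `σ` to these formulas turns `𝒳(φ; ε)` into `𝒳(φ^σ; bε mod p)`, and the
character induced from `θ_1 × ⋯ × θ_p` into the one induced from `θ_1^σ × ⋯ × θ_p^σ`. So a root
label below `p` is multiplied by `b`, the label `p` stays, and the subtrees follow by induction
(`exists_galRel_treeOf`).

The recursion defining `treeOf` makes choices, so this needs the character theory of the wreath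
product. Every irreducible character has one of the two forms (`IsIrrChar.ext_or_indProd`), both
forms are irreducible (`IsIrrChar.ext`, `isIrrChar_indProd`), they exclude each other
(`ext_ne_indProd`), and their parameters are unique (`ext_injective`), up to a cyclic shift in the
induced case (`exists_cyc_of_indProd_eq`), which a tree function does not see. Admissibility at a
vertex labelled `p` also needs that distinct characters have distinct trees (`treeOf_injective`). -/

theorem isIrreducible_of_norm_eq_one {V : Type} [AddCommGroup V] [Module ℂ V]
    [FiniteDimensional ℂ V] (ρ : Representation ℂ G V)
    (h : ∑ g, ρ.character g * ρ.character g⁻¹ = Nat.card G) : ρ.IsIrreducible := by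
  have hne : (Nat.card G : ℂ) ≠ 0 := Nat.cast_ne_zero.2 Nat.card_pos.ne'
  have : Invertible (Nat.card G : ℂ) := invertibleOfNonzero hne
  have hfr := Representation.card_inv_mul_sum_char_mul_char_eq_finrank ρ ρ
  rw [h, inv_mul_cancel₀ hne] at hfr
  have hfr1 : Module.finrank ℂ (ρ.IntertwiningMap ρ) = 1 := by exact_mod_cast hfr.symm
  have hnt : Nontrivial V := by
    by_contra hV
    rw [not_nontrivial_iff_subsingleton] at hV
    have : Subsingleton (ρ.IntertwiningMap ρ) :=
      ⟨fun a b => Representation.IntertwiningMap.ext (LinearMap.ext fun v => Subsingleton.elim _ _)⟩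
    rw [Module.finrank_zero_of_subsingleton] at hfr1
    exact zero_ne_one hfr1
  have h1 : (Representation.IntertwiningMap.id ρ) ≠ 0 := by
    intro h0
    obtain ⟨v, hv⟩ := exists_ne (0 : V)
    exact hv (congrArg (fun f : ρ.IntertwiningMap ρ => f v) h0)
  rw [Representation.irreducible_iff_isSimpleModule_asModule, isSimpleModule_iff]
  have : Nontrivial (Submodule (MonoidAlgebra ℂ G) ρ.asModule) := by
    have : Nontrivial ρ.asModule := hnt
    infer_instance
  have : NeZero (Nat.card G : ℂ) := ⟨hne⟩
  refine ⟨fun N => ?_⟩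
  obtain ⟨N', hN'⟩ := exists_isCompl N
  -- By Maschke, `N` has an invariant complement. The projection onto `N` is an endomorphism, hence
  -- a scalar `c`; `c = 0` forces `N = ⊥`, and `c ≠ 0` forces `N = ⊤`.
  let e : ρ.asModule →ₗ[MonoidAlgebra ℂ G] ρ.asModule := N.subtype ∘ₗ N.projectionOnto N' hN'
  obtain ⟨c, hc⟩ := (finrank_eq_one_iff_of_nonzero' _ h1).1 hfr1
    ((Representation.IntertwiningMap.equivLinearMapAsModule ρ ρ).symm e)
  have hv : ∀ v : V, e v = (c • v : V) := fun v =>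
    (congrArg (fun f : ρ.IntertwiningMap ρ => f v) hc).symm
  by_cases hc0 : c = 0
  · left
    rw [eq_bot_iff]
    intro v hvN
    have h2 : e v = (0 : V) := (hv v).trans (by rw [hc0]; exact zero_smul ℂ (v : V))
    have h3 : e v = v := by
      simp [e, Submodule.projectionOnto_apply_left hN' ⟨v, hvN⟩]
    rw [Submodule.mem_bot, ← h3]
    exact h2
  · right
    rw [eq_top_iff]
    intro v _
    have h2 : v = e (c⁻¹ • (v : V) : V) := by
      refine Eq.symm ((hv _).trans ?_)
      exact smul_inv_smul₀ hc0 (v : V)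
    rw [h2]
    exact (N.projectionOnto N' hN' _).2

theorem IsIrrChar.sum_mul_inv_self {χ : G → ℂ} (h : IsIrrChar χ) :
    ∑ g, χ g * χ g⁻¹ = Nat.card G := by
  obtain ⟨V, _, _, _, ρ, hρ, rfl⟩ := h
  have hne : (Nat.card G : ℂ) ≠ 0 := Nat.cast_ne_zero.2 Nat.card_pos.ne'
  have : Invertible (Nat.card G : ℂ) := invertibleOfNonzero hne
  have := Representation.char_orthonormal ρ ρ
  rw [if_pos ⟨.refl ρ⟩] at this
  field_simp at this
  exact this

theorem IsIrrChar.sum_mul_inv_of_ne {χ χ' : G → ℂ} (h : IsIrrChar χ) (h' : IsIrrChar χ')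
    (hne : χ ≠ χ') : ∑ g, χ g * χ' g⁻¹ = 0 := by
  obtain ⟨V, _, _, _, ρ, hρ, rfl⟩ := h
  obtain ⟨V', _, _, _, ρ', hρ', rfl⟩ := h'
  have hc : (Nat.card G : ℂ) ≠ 0 := Nat.cast_ne_zero.2 Nat.card_pos.ne'
  have : Invertible (Nat.card G : ℂ) := invertibleOfNonzero hc
  have := Representation.char_orthonormal ρ ρ'
  rw [if_neg fun ⟨i⟩ => hne (Representation.char_iso i).symm] at this
  exact (mul_eq_zero.1 this).resolve_left (inv_ne_zero hc)

theorem IsIrrChar.conj {G : Type} [Group G] {χ : G → ℂ} (h : IsIrrChar χ) (x g : G) :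
    χ (x * g * x⁻¹) = χ g := by
  obtain ⟨V, _, _, _, ρ, hρ, rfl⟩ := h
  exact ρ.char_conj g x

theorem IsIrrChar.exists_degree {G : Type} [Group G] {χ : G → ℂ} (h : IsIrrChar χ) :
    ∃ d : ℕ, 0 < d ∧ χ 1 = d := by
  obtain ⟨V, _, _, _, ρ, hρ, rfl⟩ := h
  refine ⟨_, ?_, ρ.char_one⟩
  rw [Module.finrank_pos_iff]
  by_contra hV
  rw [not_nontrivial_iff_subsingleton] at hV
  have := hρ.toNontrivial
  obtain ⟨S, T, hST⟩ := exists_pair_ne (Subrepresentation ρ)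
  apply hST
  apply Subrepresentation.toSubmodule_injective
  exact Subsingleton.elim _ _

/-- An invariant subspace for `G` is invariant for `H`. This reduces irreducibility over the wreath
product to its base group. -/
theorem isIrreducible_of_comp {H G : Type} [Group H] [Group G] {V : Type} [AddCommGroup V]
    [Module ℂ V] (ρ : Representation ℂ G V) (i : H →* G)
    (h : Representation.IsIrreducible (ρ.comp i : Representation ℂ H V)) : ρ.IsIrreducible := by
  let F : Subrepresentation ρ →
      Subrepresentation (ρ.comp i : Representation ℂ H V) :=
    fun S => ⟨S.toSubmodule, fun g v hv => S.apply_mem_toSubmodule (i g) hv⟩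
  have hF : ∀ S, (F S).toSubmodule = S.toSubmodule := fun _ => rfl
  have := h.toNontrivial
  have hbt : (⊥ : Submodule ℂ V) ≠ ⊤ := fun hbt => bot_ne_top
    (α := Subrepresentation (ρ.comp i : Representation ℂ H V))
    (Subrepresentation.toSubmodule_injective hbt)
  refine { exists_pair_ne := ⟨⊥, ⊤, fun hh => hbt (congrArg (·.toSubmodule) hh)⟩,
           eq_bot_or_eq_top := fun S => ?_ }
  rcases h.eq_bot_or_eq_top (F S) with h1 | h1
  · exact Or.inl (Subrepresentation.toSubmodule_injective
      (congrArg (·.toSubmodule) h1))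
  · exact Or.inr (Subrepresentation.toSubmodule_injective
      (congrArg (·.toSubmodule) h1))

theorem IsIrrChar.exists_matrix {G : Type} [Group G] {χ : G → ℂ} (h : IsIrrChar χ) :
    ∃ (d : ℕ) (M : G →* Matrix (Fin d) (Fin d) ℂ), ∀ g, χ g = (M g).trace := by
  obtain ⟨V, _, _, _, ρ, hρ, rfl⟩ := h
  let b := Module.finBasis ℂ V
  refine ⟨_, ((LinearMap.toMatrixAlgEquiv b).toMulEquiv.toMonoidHom).comp ρ, fun g => ?_⟩
  exact LinearMap.trace_eq_matrix_trace ℂ b (ρ g)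

theorem isIrrChar_of_matrix {n : Type} [Fintype n] [DecidableEq n] (M : G →* Matrix n n ℂ)
    (h : ∑ g, (M g).trace * (M g⁻¹).trace = Nat.card G) : IsIrrChar fun g => (M g).trace := by
  let ρ : Representation ℂ G (n → ℂ) := Matrix.toLinAlgEquiv'.toMulEquiv.toMonoidHom.comp M
  have hρ : ∀ g, ρ.character g = (M g).trace := fun g => Matrix.trace_toLin'_eq (M g)
  refine ⟨n → ℂ, inferInstance, inferInstance, inferInstance, ρ, ?_, funext hρ⟩
  apply isIrreducible_of_norm_eq_one
  simpa only [hρ] using h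

/-- The operator defined by a class function orthogonal to all irreducible characters vanishes on
every representation. -/
theorem sum_smul_eq_zero_of_orthogonal {f : G → ℂ} (hf : ∀ x g, f (x * g * x⁻¹) = f g)
    (h0 : ∀ χ : G → ℂ, IsIrrChar χ → ∑ g, f g * χ g⁻¹ = 0) (n : ℕ) :
    ∀ (V : Type) [AddCommGroup V] [Module ℂ V] [FiniteDimensional ℂ V]
      (ρ : Representation ℂ G V), Module.finrank ℂ V = n → ∀ v, ∑ g, f g • ρ g⁻¹ v = 0 := by
  induction n using Nat.strong_induction_on with
  | _ n ih =>
  intro V _ _ _ ρ hn v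
  rcases subsingleton_or_nontrivial V with hV | hV
  · exact Subsingleton.elim _ _
  have hc : (Nat.card G : ℂ) ≠ 0 := Nat.cast_ne_zero.2 Nat.card_pos.ne'
  have : NeZero (Nat.card G : ℂ) := ⟨hc⟩
  have hlt : ∀ S : Subrepresentation ρ, S ≠ ⊤ → ∀ v ∈ S.toSubmodule,
      ∑ g, f g • ρ g⁻¹ v = 0 := by
    intro S hS v hv
    have hlt : Module.finrank ℂ S.toSubmodule < n := by
      rw [← hn]
      apply Submodule.finrank_lt
      exact fun h => hS (Subrepresentation.toSubmodule_injective h)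
    have := ih _ hlt S.toSubmodule S.toRepresentation rfl ⟨v, hv⟩
    have := congrArg S.toSubmodule.subtype this
    rw [map_sum, map_zero] at this
    exact this
  by_cases hirr : ρ.IsIrreducible
  · let T : V →ₗ[ℂ] V := ∑ g, f g • ρ g⁻¹
    have hT : ∀ v, T v = ∑ g, f g • ρ g⁻¹ v := fun v => by simp [T, LinearMap.sum_apply]
    -- Since `f` is a class function, `T` commutes with `G`. By Schur it is a scalar, and its trace,
    -- a pairing of `f` with an irreducible character, is zero.
    let I : ρ.IntertwiningMap ρ :=
      { toLinearMap := T
        isIntertwining' := fun x => by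
          ext v
          simp only [LinearMap.comp_apply, hT, map_sum, map_smul]
          refine Fintype.sum_equiv (MulAut.conj x⁻¹).toEquiv _ _ fun g => ?_
          simp only [MulEquiv.toEquiv_eq_coe, EquivLike.coe_coe, MulAut.conj_apply, hf]
          rw [← Module.End.mul_apply, ← Module.End.mul_apply, ← map_mul, ← map_mul]
          congr 3
          group }
    obtain ⟨c, hcI⟩ := 
      (Representation.IsIrreducible.algebraMap_intertwiningMap_bijective_of_isAlgClosed (ρ := ρ)).2 I
    have hTc : T = c • LinearMap.id := by
      ext v
      exact (congrArg (fun f : ρ.IntertwiningMap ρ => f v) hcI).symm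
    have htr : LinearMap.trace ℂ V T = 0 := by
      rw [← h0 ρ.character ⟨V, _, _, inferInstance, ρ, hirr, rfl⟩]
      simp [T, map_sum, Representation.character]
    rw [hTc, map_smul, LinearMap.trace_id, smul_eq_mul, mul_eq_zero] at htr
    rcases htr with h | h
    · rw [← hT, hTc, h, zero_smul]; rfl
    · exact absurd (Nat.cast_eq_zero.1 h) (Module.finrank_pos (R := ℂ) (M := V)).ne'
  · have : Nontrivial (Subrepresentation ρ) :=
      ⟨⊥, ⊤, fun h => bot_ne_top (α := Submodule ℂ V) (congrArg (·.toSubmodule) h)⟩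
    obtain ⟨S, hS⟩ : ∃ S : Subrepresentation ρ, ¬ (S = ⊥ ∨ S = ⊤) := by
      by_contra! hcon
      exact hirr ⟨hcon⟩
    push Not at hS
    -- Reducible case: Maschke splits `V` into two proper invariant subspaces, where induction on
    -- the dimension applies.
    obtain ⟨S', hSS'⟩ := exists_isCompl S
    have hS' : S' ≠ ⊤ := by
      rintro rfl
      exact hS.1 (by simpa using hSS'.disjoint)
    have hv : v ∈ S.toSubmodule ⊔ S'.toSubmodule := by
      rw [← Subrepresentation.toSubmodule_sup, hSS'.sup_eq_top]
      trivial
    obtain ⟨a, ha, b, hb, rfl⟩ := Submodule.mem_sup.1 hv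
    simp only [map_add, smul_add, Finset.sum_add_distrib]
    rw [hlt S hS.2 a ha, hlt S' hS' b hb, add_zero]

/-- In the left regular representation, the vanishing operator sends the delta function at `1` to a
function whose value at `x⁻¹` is `f x`. -/
theorem eq_zero_of_orthogonal {f : G → ℂ} (hf : ∀ x g, f (x * g * x⁻¹) = f g)
    (h0 : ∀ χ : G → ℂ, IsIrrChar χ → ∑ g, f g * χ g⁻¹ = 0) : f = 0 := by
  classical
  let ρ : Representation ℂ G (G → ℂ) :=
    { toFun := fun g => LinearMap.funLeft ℂ ℂ (g⁻¹ * ·)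
      map_one' := by ext; simp [LinearMap.funLeft]
      map_mul' := fun a b => by ext; simp [LinearMap.funLeft, mul_assoc] }
  have h1 := sum_smul_eq_zero_of_orthogonal hf h0 _ (G → ℂ) ρ rfl (Pi.single 1 1)
  ext x
  have h2 := congrFun h1 x⁻¹
  simpa [ρ, Finset.sum_apply, LinearMap.funLeft, Pi.single_apply, mul_inv_eq_one] using h2

omit [Group G] in
theorem sum_fun_succ {n : ℕ} (F : (Fin (n + 1) → G) → ℂ) :
    ∑ f, F f = ∑ f : Fin n → G, ∑ g : G, F (Fin.cons g f) := by
  rw [← (Fin.consEquiv fun _ => G).sum_comp, Fintype.sum_prod_type, Finset.sum_comm]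
  rfl

/-- Pairing off one coordinate at a time reduces to a single factor, so the irreducible characters
of a direct power need not be classified. -/
theorem eq_zero_of_orthogonal_prod {n : ℕ} {F : (Fin n → G) → ℂ}
    (hF : ∀ x g, F (x * g * x⁻¹) = F g)
    (h0 : ∀ ψ : Fin n → G → ℂ, (∀ i, IsIrrChar (ψ i)) → ∑ f, F f * ∏ i, ψ i (f i)⁻¹ = 0) :
    F = 0 := by
  induction n with
  | zero =>
    have := h0 (fun i => i.elim0) (fun i => i.elim0)
    ext f
    simpa [Subsingleton.elim _ f] using this
  | succ n ih =>
    have h1 : ∀ χ : G → ℂ, IsIrrChar χ →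
        (fun f : Fin n → G => ∑ g, F (Fin.cons g f) * χ g⁻¹) = 0 := by
      intro χ hχ
      apply ih
      · intro x f
        refine Finset.sum_congr rfl fun g _ => ?_
        rw [← hF (Fin.cons 1 x) (Fin.cons g f)]
        congr 2
        ext i
        refine Fin.cases ?_ (fun i => ?_) i <;> simp
      · intro ψ hψ
        rw [← h0 (Fin.cons χ ψ) (fun i => by
          refine Fin.cases ?_ (fun i => ?_) i
          · exact hχ
          · exact hψ i)]
        rw [sum_fun_succ]
        refine Finset.sum_congr rfl fun f _ => ?_
        rw [Finset.sum_mul]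
        refine Finset.sum_congr rfl fun g _ => ?_
        rw [Fin.prod_univ_succ]
        simp [mul_assoc]
    ext f
    rw [← Fin.cons_self_tail f]
    refine congrFun (eq_zero_of_orthogonal (f := fun g => F (Fin.cons g (Fin.tail f))) ?_ ?_) (f 0)
    · intro x g
      rw [← hF (Fin.cons x 1) (Fin.cons g (Fin.tail f))]
      congr 1
      ext i
      refine Fin.cases ?_ (fun i => ?_) i <;> simp
    · intro χ hχ
      exact congrFun (h1 χ hχ) (Fin.tail f)

theorem sum_prod_mul_prod_inv {n : ℕ} (α β : Fin n → G → ℂ) :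
    ∑ f : Fin n → G, (∏ i, α i (f i)) * ∏ i, β i (f i)⁻¹ = ∏ i, ∑ g, α i g * β i g⁻¹ := by
  simp_rw [← Finset.prod_mul_distrib, Finset.prod_univ_sum, Fintype.piFinset_univ]

open Classical in
theorem sum_prod_irr {n : ℕ} {α β : Fin n → G → ℂ} (hα : ∀ i, IsIrrChar (α i))
    (hβ : ∀ i, IsIrrChar (β i)) :
    ∑ f : Fin n → G, (∏ i, α i (f i)) * ∏ i, β i (f i)⁻¹ =
      if α = β then (Nat.card G : ℂ) ^ n else 0 := by
  rw [sum_prod_mul_prod_inv]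
  split_ifs with h
  · subst h
    simp [(hα _).sum_mul_inv_self]
  · obtain ⟨i, hi⟩ := Function.ne_iff.1 h
    exact Finset.prod_eq_zero (Finset.mem_univ i) ((hα i).sum_mul_inv_of_ne (hβ i) hi)

end Characters

/-! ### The cyclic group generated by the rotation -/

section Cyclic

variable {p : ℕ} [Fact p.Prime]

/-- The first letter of `Fin p`. -/
def firstLetter (p : ℕ) [Fact p.Prime] : Fin p := ⟨0, (Fact.out : p.Prime).pos⟩

/-- Powers of the rotation are translations modulo `p`, so each is determined by the image of the
first letter. -/
theorem cyc_val (δ : Cyc p) (i : Fin p) :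
    ((δ : Perm (Fin p)) i : ℕ) = (i + (δ : Perm (Fin p)) (firstLetter p)) % p := by
  obtain ⟨_, n, rfl⟩ := δ
  change (((finRotate p) ^ n) i : ℕ) = (i + ((finRotate p) ^ n) (firstLetter p)) % p
  have hr : ∀ j : Fin p, (finRotate p j : ℕ) = (j + 1) % p := rot_val p
  have key : ∀ i : Fin p, (((finRotate p) ^ n) i : ℤ) ≡ i + n [ZMOD p] := by
    induction n using Int.induction_on with
    | zero => intro i; simp
    | succ n ih =>
      intro i
      rw [zpow_add_one, Perm.mul_apply]
      refine (ih _).trans ?_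
      rw [hr]
      push_cast
      refine ((Int.mod_modEq _ _).add_right _).trans ?_
      rw [show (i : ℤ) + 1 + n = i + (n + 1) by ring]
    | pred n ih =>
      intro i
      obtain ⟨j, rfl⟩ := (finRotate p).surjective i
      have : ((finRotate p) ^ (-(n : ℤ) - 1)) (finRotate p j) = ((finRotate p) ^ (-(n : ℤ))) j := by
        rw [← Perm.mul_apply, ← zpow_add_one, sub_add_cancel]
      rw [this]
      refine (ih _).trans ?_
      rw [hr]
      push_cast
      refine Int.ModEq.trans ?_ ((Int.mod_modEq _ _).symm.add_right _)
      rw [show (j : ℤ) + 1 + (-n - 1) = j + -n by ring]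
  have h1 := key i
  have h2 := key (firstLetter p)
  have h3 : (((finRotate p) ^ n) i : ℤ) ≡
      ((i + ((finRotate p) ^ n) (firstLetter p) : ℕ) : ℤ) [ZMOD p] := by
    push_cast
    refine h1.trans ?_
    have : ((firstLetter p : Fin p) : ℤ) = 0 := rfl
    rw [this, zero_add] at h2
    exact h2.symm.add_left _
  have h4 := Int.natCast_modEq_iff.1 h3
  rw [← Nat.mod_eq_of_lt (((finRotate p) ^ n) i).2]
  exact h4

theorem cyc_ext {δ δ' : Cyc p}
    (h : (δ : Perm (Fin p)) (firstLetter p) = (δ' : Perm (Fin p)) (firstLetter p)) : δ = δ' := by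
  apply Subtype.ext
  ext i
  rw [cyc_val, cyc_val δ', h]

theorem cyc_pow_val (δ : Cyc p) (m : ℕ) :
    (((δ ^ m : Cyc p) : Perm (Fin p)) (firstLetter p) : ℕ) =
      (m * (δ : Perm (Fin p)) (firstLetter p)) % p := by
  induction m with
  | zero => simp [firstLetter]
  | succ m ih =>
    rw [pow_succ', Subgroup.coe_mul, Perm.mul_apply, cyc_val, ih, Nat.mod_add_mod, Nat.succ_mul]

/-- A nonzero translation amount is invertible modulo the prime `p`, so a nontrivial element acts
transitively. -/
theorem cyc_pow_surjective {δ : Cyc p} (hδ : δ ≠ 1) (i : Fin p) :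
    ∃ m : ℕ, ((δ ^ m : Cyc p) : Perm (Fin p)) (firstLetter p) = i := by
  have hp : p.Prime := Fact.out
  have h0 : ((δ : Perm (Fin p)) (firstLetter p) : ℕ) ≠ 0 := fun h => hδ (cyc_ext (Fin.ext h))
  have hcop : Nat.Coprime ((δ : Perm (Fin p)) (firstLetter p)) p :=
    (Nat.coprime_of_lt_prime h0 (Fin.is_lt _) hp).symm
  obtain ⟨m, hm⟩ := Nat.exists_mul_mod_eq_of_coprime i hcop hp.ne_zero
  refine ⟨m, Fin.ext ?_⟩
  rw [cyc_pow_val, mul_comm, hm.2, Nat.mod_eq_of_lt i.2]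

theorem rot_ne_one : rot p ≠ 1 := by
  intro h
  have := rot_val p (firstLetter p)
  rw [h] at this
  simp [firstLetter, Nat.mod_eq_of_lt (Fact.out : p.Prime).one_lt] at this

theorem exists_cyc_apply (i : Fin p) : ∃ δ : Cyc p, (δ : Perm (Fin p)) (firstLetter p) = i := by
  obtain ⟨m, hm⟩ := cyc_pow_surjective (rot_ne_one (p := p)) i
  exact ⟨_, hm⟩

/-- Evaluation at the first letter. -/
noncomputable def cycEquiv (p : ℕ) [Fact p.Prime] : Cyc p ≃ Fin p :=
  Equiv.ofBijective (fun δ => (δ : Perm (Fin p)) (firstLetter p))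
    ⟨fun _ _ h => cyc_ext h, exists_cyc_apply⟩

theorem card_cyc : Nat.card (Cyc p) = p := by
  rw [Nat.card_congr (cycEquiv p), Nat.card_fin]

theorem cyc_comm (δ δ' : Cyc p) : δ * δ' = δ' * δ := by
  apply cyc_ext
  apply Fin.ext
  simp only [Subgroup.coe_mul, Perm.mul_apply]
  rw [cyc_val δ ((δ' : Perm (Fin p)) _), cyc_val δ' ((δ : Perm (Fin p)) _), add_comm]

theorem eq_const_of_comp_cyc {X : Type*} {ψ : Fin p → X} {δ : Cyc p} (hδ : δ ≠ 1)
    (h : ∀ i, ψ ((δ : Perm (Fin p)) i) = ψ i) (i : Fin p) : ψ i = ψ (firstLetter p) := by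
  obtain ⟨m, rfl⟩ := cyc_pow_surjective hδ i
  induction m with
  | zero => rfl
  | succ m ih => rw [pow_succ', Subgroup.coe_mul, Perm.mul_apply, h, ih]

theorem zetaP_primitive : IsPrimitiveRoot (zetaP p) p :=
  Complex.isPrimitiveRoot_exp p (Fact.out : p.Prime).ne_zero

theorem zetaP_pow_mod (n : ℕ) : zetaP p ^ (n % p) = zetaP p ^ n := by
  conv_rhs => rw [← Nat.mod_add_div n p, pow_add, pow_mul, zetaP_primitive.pow_eq_one, one_pow,
    mul_one]

theorem phi_eq (ε : Fin p) (δ : Cyc p) :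
    phi p ε δ = zetaP p ^ ((ε : ℕ) * ((δ : Perm (Fin p)) (firstLetter p) : ℕ)) := rfl

theorem phi_mul (ε : Fin p) (δ δ' : Cyc p) : phi p ε (δ * δ') = phi p ε δ * phi p ε δ' := by
  rw [phi_eq, Subgroup.coe_mul, Perm.mul_apply, cyc_val, ← zetaP_pow_mod, Nat.mul_mod_mod,
    zetaP_pow_mod, mul_add, pow_add, mul_comm, phi_eq, phi_eq]

theorem phi_one (ε : Fin p) : phi p ε 1 = 1 := by
  rw [phi_eq]; simp [firstLetter]

theorem phi_rot (ε : Fin p) : phi p ε (rot p) = zetaP p ^ (ε : ℕ) := by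
  have : (((rot p : Cyc p) : Perm (Fin p)) (firstLetter p) : ℕ) = 1 := by
    rw [rot_val]
    exact Nat.mod_eq_of_lt (Fact.out : p.Prime).one_lt
  rw [phi_eq, this, mul_one]

theorem phi_ne_zero (ε : Fin p) (δ : Cyc p) : phi p ε δ ≠ 0 :=
  pow_ne_zero _ (zetaP_primitive.ne_zero (Fact.out : p.Prime).ne_zero)

theorem sum_phi_one : ∑ ε : Fin p, phi p ε 1 = p := by simp [phi_one]

theorem sum_phi {δ : Cyc p} (hδ : δ ≠ 1) : ∑ ε : Fin p, phi p ε δ = 0 := by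
  have hp : p.Prime := Fact.out
  have h0 : ((δ : Perm (Fin p)) (firstLetter p) : ℕ) ≠ 0 := fun h => hδ (cyc_ext (Fin.ext h))
  have hcop : Nat.Coprime ((δ : Perm (Fin p)) (firstLetter p)) p :=
    (Nat.coprime_of_lt_prime h0 (Fin.is_lt _) hp).symm
  have h1 := (zetaP_primitive (p := p)).pow_of_coprime _ hcop
  rw [← h1.geom_sum_eq_zero hp.one_lt, ← Fin.sum_univ_eq_sum_range
    (fun i => (zetaP p ^ ((δ : Perm (Fin p)) (firstLetter p) : ℕ)) ^ i)]
  refine Finset.sum_congr rfl fun ε _ => ?_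
  rw [phi_eq, ← pow_mul, mul_comm]

end Cyclic

/-! ### The tensor power character -/

section Tensor

variable {p : ℕ} [Fact p.Prime] {G : Type} [Group G]

omit [Fact p.Prime] in
theorem wr_mul_right (x y : Wr p G) : (x * y).right = x.right * y.right := rfl

omit [Fact p.Prime] in
theorem wr_inv_left (x : Wr p G) (i : Fin p) :
    (x⁻¹).left i = (x.left ((x.right : Perm (Fin p)) i))⁻¹ := rfl

omit [Fact p.Prime] in
theorem wr_inv_right (x : Wr p G) : (x⁻¹).right = x.right⁻¹ := rfl

/-- Conjugation by `h` replaces `w_i` by `h_i w_i h_{δ⁻¹ i}⁻¹`. As `δ` is a single cycle, `h` can be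
solved for along it so that all coordinates but the first become trivial. -/
theorem exists_conj_mulSingle (w : Wr p G) (hw : w.right ≠ 1) :
    ∃ (h : Fin p → G) (g : G), SemidirectProduct.inl h * w * (SemidirectProduct.inl h)⁻¹ =
      (⟨Pi.mulSingle (firstLetter p) g, w.right⟩ : Wr p G) := by
  classical
  -- `N i` is the number of steps from the first letter to `i` along the cycle.
  let N : Fin p → ℕ := fun i => Nat.find (cyc_pow_surjective hw i)
  have hN : ∀ i, ((w.right ^ N i : Cyc p) : Perm (Fin p)) (firstLetter p) = i :=
    fun i => Nat.find_spec (cyc_pow_surjective hw i)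
  have hmin : ∀ i m, ((w.right ^ m : Cyc p) : Perm (Fin p)) (firstLetter p) = i → N i ≤ m :=
    fun i m hm => Nat.find_min' (cyc_pow_surjective hw i) hm
  -- The recursion `h_i = h_{δ⁻¹ i} w_i⁻¹` along the cycle, started at `1`.
  let H : ℕ → G := fun m => Nat.rec 1 (fun m x =>
    x * (w.left (((w.right ^ (m + 1) : Cyc p) : Perm (Fin p)) (firstLetter p)))⁻¹) m
  have hH : ∀ m, H (m + 1) =
    H m * (w.left (((w.right ^ (m + 1) : Cyc p) : Perm (Fin p)) (firstLetter p)))⁻¹ := fun _ => rfl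
  have hstep : ∀ i, i ≠ firstLetter p → N i = N ((w.right : Perm (Fin p))⁻¹ i) + 1 := by
    intro i hi
    apply le_antisymm
    · apply hmin
      rw [pow_succ', Subgroup.coe_mul, Perm.mul_apply, hN]
      simp
    · cases hm : N i with
      | zero =>
        have := hN i
        rw [hm] at this
        exact absurd this.symm hi
      | succ m =>
        apply Nat.succ_le_succ
        apply hmin
        have := hN i
        rw [hm, pow_succ', Subgroup.coe_mul, Perm.mul_apply] at this
        rw [← this]
        simp
  refine ⟨fun i => H (N i), (SemidirectProduct.inl (fun i => H (N i)) * w *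
    (SemidirectProduct.inl (fun i => H (N i)))⁻¹ : Wr p G).left (firstLetter p), ?_⟩
  have hleft : ∀ i, (SemidirectProduct.inl (fun i => H (N i)) * w *
      (SemidirectProduct.inl (fun i => H (N i)))⁻¹ : Wr p G).left i =
      H (N i) * w.left i * (H (N ((w.right : Perm (Fin p))⁻¹ i)))⁻¹ := by
    intro i
    rw [wr_mul_left, wr_mul_left, wr_inv_left, wr_mul_right]
    simp
  refine SemidirectProduct.ext (funext fun i => ?_) ?_
  · by_cases hi : i = firstLetter p
    · subst hi
      simp
    · dsimp only
      rw [Pi.mulSingle_eq_of_ne hi, hleft, hstep i hi, hH, ← hstep i hi, hN]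
      group
  · rw [wr_mul_right, wr_mul_right, wr_inv_right]
    simp

open Classical in
/-- An element `g` with the property that `w` is conjugate to `(g, 1, …, 1; δ)`, for `w` outside
the base group. -/
noncomputable def cyclePart (w : Wr p G) : G :=
  if hw : w.right = 1 then 1 else (exists_conj_mulSingle w hw).choose_spec.choose

theorem exists_conj_cyclePart {w : Wr p G} (hw : w.right ≠ 1) :
    ∃ h : Fin p → G, SemidirectProduct.inl h * w * (SemidirectProduct.inl h)⁻¹ =
      (⟨Pi.mulSingle (firstLetter p) (cyclePart w), w.right⟩ : Wr p G) := by
  rw [cyclePart, dif_neg hw]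
  exact ⟨_, (exists_conj_mulSingle w hw).choose_spec.choose_spec⟩

variable {V : Type} [AddCommGroup V] [Module ℂ V] [FiniteDimensional ℂ V]

omit [Fact p.Prime] in
theorem tensorRep_character (ρ : Representation ℂ G V) (w : Wr p G) :
    (tensorRep p ρ).character w = ∑ e : Fin p → Fin (Module.finrank ℂ V), ∏ i,
      LinearMap.toMatrix (Module.finBasis ℂ V) (Module.finBasis ℂ V) (ρ (w.left i)) (e i)
        (e ((w.right : Perm (Fin p))⁻¹ i)) := by
  rw [Representation.character, LinearMap.trace_eq_matrix_trace ℂ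
    (Basis.piTensorProduct fun _ : Fin p => Module.finBasis ℂ V), Matrix.trace]
  refine Finset.sum_congr rfl fun e _ => ?_
  rw [Matrix.diag_apply, LinearMap.toMatrix_apply, Basis.piTensorProduct_apply, tensorRep_tprod,
    Basis.piTensorProduct_repr_tprod_apply]
  simp only [LinearMap.toMatrix_apply]

omit [Fact p.Prime] in
theorem tensorRep_character_base (ρ : Representation ℂ G V) {w : Wr p G} (hw : w.right = 1) :
    (tensorRep p ρ).character w = ∏ i, ρ.character (w.left i) := by
  rw [tensorRep_character, hw]
  simp only [Representation.character, LinearMap.trace_eq_matrix_trace ℂ (Module.finBasis ℂ V),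
    Matrix.trace, Matrix.diag_apply, Finset.prod_univ_sum, Fintype.piFinset_univ]
  rfl

/-- In the basis of pure tensors, identity factors force neighbouring indices to agree. By
transitivity only constant index tuples survive, and they sum to the trace of `ρ g`. -/
theorem tensorRep_character_mulSingle (ρ : Representation ℂ G V) {δ : Cyc p} (hδ : δ ≠ 1) (g : G) :
    (tensorRep p ρ).character ⟨Pi.mulSingle (firstLetter p) g, δ⟩ = ρ.character g := by
  classical
  rw [tensorRep_character, Representation.character,
    LinearMap.trace_eq_matrix_trace ℂ (Module.finBasis ℂ V), Matrix.trace]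
  symm
  refine Fintype.sum_of_injective (fun c => fun _ : Fin p => c)
    (fun a b h => congrFun h (firstLetter p)) _ _ ?_ ?_
  · intro e he
    by_contra hne
    apply he
    refine ⟨e (firstLetter p), funext fun j => ?_⟩
    have h1 : ∀ i, i ≠ firstLetter p → e ((δ : Perm (Fin p))⁻¹ i) = e i := by
      intro i hi
      have h2 := Finset.prod_ne_zero_iff.1 hne i (Finset.mem_univ i)
      dsimp only at h2
      rw [Pi.mulSingle_eq_of_ne hi, map_one, Module.End.one_eq_id, LinearMap.toMatrix_id,
        Matrix.one_apply] at h2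
      by_contra h3
      exact h2 (if_neg fun h4 => h3 h4.symm)
    obtain ⟨m, rfl⟩ := cyc_pow_surjective hδ j
    induction m with
    | zero => rfl
    | succ m ih =>
      rw [ih]
      by_cases h3 : ((δ ^ (m + 1) : Cyc p) : Perm (Fin p)) (firstLetter p) = firstLetter p
      · rw [h3, ← ih]
      · rw [← h1 _ h3, pow_succ', Subgroup.coe_mul, Perm.mul_apply]
        simp
  · intro c
    rw [Finset.prod_eq_single (firstLetter p)]
    · dsimp only
      rw [Pi.mulSingle_eq_same, Matrix.diag_apply]
    · intro i _ hi
      dsimp only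
      rw [Pi.mulSingle_eq_of_ne hi, map_one, Module.End.one_eq_id, LinearMap.toMatrix_id,
        Matrix.one_apply_eq]
    · simp

open Classical in
/-- The character of the tensor power representation in terms of the character `φ`. -/
noncomputable def extVal (φ : G → ℂ) (w : Wr p G) : ℂ :=
  if w.right = 1 then ∏ i, φ (w.left i) else φ (cyclePart w)

/-- The tensor power character depends on `φ` alone, not on the module, and each value is a product
of values of `φ`. This is what lets `σ` act on it. -/
theorem tensorRep_character_eq (ρ : Representation ℂ G V) (w : Wr p G) :
    (tensorRep p ρ).character w = extVal ρ.character w := by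
  unfold extVal
  split_ifs with hw
  · exact tensorRep_character_base ρ hw
  · obtain ⟨h, hh⟩ := exists_conj_cyclePart hw
    rw [← Representation.char_conj _ w (SemidirectProduct.inl h), hh,
      tensorRep_character_mulSingle ρ hw]

theorem extVal_inl (φ : G → ℂ) (f : Fin p → G) :
    extVal φ (SemidirectProduct.inl f : Wr p G) = ∏ i, φ (f i) := by
  exact if_pos rfl

theorem IsIrrChar.extVal_rot {φ : G → ℂ} (h : IsIrrChar φ) :
    extVal φ (SemidirectProduct.inr (rot p) : Wr p G) = φ 1 := by
  obtain ⟨V, _, _, _, ρ, hρ, rfl⟩ := h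
  rw [← tensorRep_character_eq, ← tensorRep_character_mulSingle ρ (rot_ne_one (p := p)) 1,
    Pi.mulSingle_one]
  rfl

theorem isExtChar_iff {φ : G → ℂ} (hφ : IsIrrChar φ) (ε : Fin p) (χ : Wr p G → ℂ) :
    IsExtChar φ ε χ ↔ χ = fun w => extVal φ w * phi p ε w.right := by
  constructor
  · rintro ⟨V, _, _, _, ρ, rfl, h⟩
    ext w
    rw [h, tensorRep_character_eq]
  · rintro rfl
    obtain ⟨V, _, _, _, ρ, hρ, rfl⟩ := hφ
    refine ⟨V, _, _, inferInstance, ρ, rfl, fun w => ?_⟩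
    rw [tensorRep_character_eq]

/-- The restriction to the base group is `φ × ⋯ × φ`, which already has norm one. -/
theorem IsIrrChar.ext [Finite G] {φ : G → ℂ} (hφ : IsIrrChar φ) (ε : Fin p) :
    IsIrrChar fun w : Wr p G => extVal φ w * phi p ε w.right := by
  have := Fintype.ofFinite G
  have hφ' := hφ
  obtain ⟨V, _, _, _, ρ, hρ, rfl⟩ := hφ
  let R : Representation ℂ (Wr p G) (⨂[ℂ] _ : Fin p, V) :=
    { toFun := fun w => phi p ε w.right • tensorRep p ρ w
      map_one' := by rw [SemidirectProduct.one_right, phi_one, map_one, one_smul]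
      map_mul' := fun x y => by rw [wr_mul_right, phi_mul, map_mul, smul_mul_smul_comm] }
  have hR : R.character = fun w : Wr p G => extVal ρ.character w * phi p ε w.right := by
    ext w
    rw [← tensorRep_character_eq, mul_comm]
    exact (LinearMap.trace ℂ _).map_smul _ _
  have hfin : FiniteDimensional ℂ (⨂[ℂ] _ : Fin p, V) :=
    Module.Finite.of_basis (Basis.piTensorProduct fun _ : Fin p => Module.finBasis ℂ V)
  refine ⟨_, _, _, hfin, R, ?_, hR⟩
  refine isIrreducible_of_comp R (SemidirectProduct.inl : (Fin p → G) →* Wr p G) ?_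
  apply isIrreducible_of_norm_eq_one
  have h1 : ∀ f : Fin p → G, Representation.character (R.comp SemidirectProduct.inl) f =
      ∏ i, ρ.character (f i) := by
    intro f
    rw [show Representation.character (R.comp SemidirectProduct.inl) f =
      R.character (SemidirectProduct.inl f) from rfl, hR]
    simp only [extVal_inl, SemidirectProduct.right_inl, phi_one, mul_one]
  simp only [h1, Pi.inv_apply]
  rw [sum_prod_irr (fun _ => hφ') (fun _ => hφ'), if_pos rfl]
  simp

/-- The base group sees `φ` only through products. The degrees agree because positive integers have
unique `p`-th roots; elements with one nontrivial coordinate then recover `φ`, and the value `φ(1)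
ω^ε` at the rotation recovers `ε`. -/
theorem ext_injective {φ φ' : G → ℂ} {ε ε' : Fin p} (hφ : IsIrrChar φ) (hφ' : IsIrrChar φ')
    (h : ∀ w : Wr p G, extVal φ w * phi p ε w.right = extVal φ' w * phi p ε' w.right) :
    φ = φ' ∧ ε = ε' := by
  classical
  have hp : p.Prime := Fact.out
  have hbase : ∀ f : Fin p → G, ∏ i, φ (f i) = ∏ i, φ' (f i) := by
    intro f
    simpa only [extVal_inl, SemidirectProduct.right_inl, phi_one, mul_one] using
      h (SemidirectProduct.inl f)
  obtain ⟨d, hd, hd1⟩ := hφ.exists_degree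
  obtain ⟨d', hd', hd1'⟩ := hφ'.exists_degree
  have hdd : d = d' := by
    have := hbase 1
    simp only [Pi.one_apply, hd1, hd1', Finset.prod_const, Finset.card_univ,
      Fintype.card_fin] at this
    exact Nat.pow_left_injective hp.ne_zero (by exact_mod_cast this)
  have hd0 : (d : ℂ) ≠ 0 := Nat.cast_ne_zero.2 hd.ne'
  have hval : ∀ (χ : G → ℂ) (g : G), ∏ i, χ ((Pi.mulSingle (firstLetter p) g : Fin p → G) i) =
      χ g * χ 1 ^ (p - 1) := by
    intro χ g
    rw [← Finset.mul_prod_erase _ _ (Finset.mem_univ (firstLetter p)), Pi.mulSingle_eq_same]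
    congr 1
    rw [Finset.prod_congr rfl fun i hi => by
      rw [Pi.mulSingle_eq_of_ne (Finset.ne_of_mem_erase hi)]]
    simp [Finset.card_erase_of_mem]
  refine ⟨funext fun g => ?_, Fin.ext ?_⟩
  · have := hbase (Pi.mulSingle (firstLetter p) g)
    rw [hval, hval, hd1, hd1', ← hdd] at this
    exact mul_right_cancel₀ (pow_ne_zero _ hd0) this
  · have := h (SemidirectProduct.inr (rot p))
    rw [hφ.extVal_rot, hφ'.extVal_rot, hd1, hd1', ← hdd, SemidirectProduct.right_inr, phi_rot,
      phi_rot] at this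
    exact zetaP_primitive.pow_inj ε.2 ε'.2 (mul_left_cancel₀ hd0 this)

end Tensor

/-! ### Induced characters of the wreath product -/

section Induced

variable {p : ℕ} [Fact p.Prime] {G : Type} [Group G]

omit [Fact p.Prime] in
theorem mem_baseGroup_iff (w : Wr p G) : w ∈ baseGroup p G ↔ w.right = 1 := by
  rw [baseGroup, SemidirectProduct.range_inl_eq_ker_rightHom, MonoidHom.mem_ker]
  rfl

omit [Fact p.Prime] in
theorem inr_mul_inl_mul_inv (δ : Cyc p) (f : Fin p → G) :
    (SemidirectProduct.inr δ * SemidirectProduct.inl f * (SemidirectProduct.inr δ)⁻¹ : Wr p G) =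
      SemidirectProduct.inl fun i => f ((δ : Perm (Fin p))⁻¹ i) := by
  rw [← map_inv, ← SemidirectProduct.inl_aut]
  rfl

noncomputable instance [Finite G] : Fintype (Wr p G) :=
  have : Finite (Wr p G) := Finite.of_equiv _ SemidirectProduct.equivProd.symm
  Fintype.ofFinite _

omit [Fact p.Prime] in
theorem sum_wr [Fintype G] (F : Wr p G → ℂ) :
    ∑ w, F w = ∑ δ : Cyc p, ∑ f : Fin p → G, F ⟨f, δ⟩ := by
  rw [← (SemidirectProduct.equivProd
    (φ := (mulAutArrow : Cyc p →* MulAut (Fin p → G)))).symm.sum_comp, Fintype.sum_prod_type,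
    Finset.sum_comm]
  rfl

omit [Fact p.Prime] in
theorem sum_wr_of_base [Fintype G] (F : Wr p G → ℂ) (hF : ∀ w, w.right ≠ 1 → F w = 0) :
    ∑ w, F w = ∑ f : Fin p → G, F (SemidirectProduct.inl f) := by
  rw [sum_wr, Finset.sum_eq_single 1]
  · rfl
  · exact fun δ _ hδ => Finset.sum_eq_zero fun f _ => hF _ hδ
  · simp

theorem card_wr : Nat.card (Wr p G) = Nat.card G ^ p * p := by
  rw [Nat.card_congr SemidirectProduct.equivProd, Nat.card_prod, card_cyc, Nat.card_pi]
  simp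

/-- The quotient by the base group is abelian, so no conjugate of `w` lies in the base group. -/
theorem indProd_of_right_ne_one [Finite G] (θ : Fin p → G → ℂ) {w : Wr p G} (hw : w.right ≠ 1) :
    indProd θ w = 0 := by
  rw [indProd, indChar, finsum_eq_zero_of_forall_eq_zero, mul_zero]
  intro x
  rw [dif_neg]
  rw [mem_baseGroup_iff, wr_mul_right, wr_mul_right, wr_inv_right, cyc_comm _ w.right,
    inv_mul_cancel_right]
  exact hw

omit [Fact p.Prime] in
theorem indChar_of_forall {H : Subgroup G} {χ : H → ℂ} {g : G} (F : G → ℂ)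
    (hF : ∀ x, ∃ h : x⁻¹ * g * x ∈ H, χ ⟨x⁻¹ * g * x, h⟩ = F x) :
    indChar H χ g = (Nat.card H : ℂ)⁻¹ * ∑ᶠ x, F x := by
  rw [indChar]
  congr 1
  refine finsum_congr fun x => ?_
  obtain ⟨h, hx⟩ := hF x
  rw [dif_pos h, hx]

-- Conjugation by `x` permutes coordinates by `x.right` and conjugates within each. The base part of
-- `x` does not matter, and summing over it cancels the order of the base group.
omit [Fact p.Prime] in
theorem indProd_inl [Finite G] {θ : Fin p → G → ℂ} (hθ : ∀ i x g, θ i (x * g * x⁻¹) = θ i g)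
    (f : Fin p → G) :
    indProd θ (SemidirectProduct.inl f : Wr p G) =
      ∑ δ : Cyc p, ∏ i, θ i (f ((δ : Perm (Fin p)) i)) := by
  have := Fintype.ofFinite G
  have hcard : (Nat.card (baseGroup p G) : ℂ) = Nat.card G ^ p := by
    rw [baseGroup, Nat.card_congr (MonoidHom.ofInjective
      SemidirectProduct.inl_injective).toEquiv.symm, Nat.card_pi]
    simp
  have hne : (Nat.card G : ℂ) ^ p ≠ 0 := pow_ne_zero _ (Nat.cast_ne_zero.2 Nat.card_pos.ne')
  rw [indProd, indChar_of_forall fun x => ∏ i, θ i (f ((x.right : Perm (Fin p)) i)), hcard,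
    inv_mul_eq_iff_eq_mul₀ hne, finsum_eq_sum_of_fintype, sum_wr, Finset.mul_sum]
  · refine Finset.sum_congr rfl fun δ _ => ?_
    simp
  · intro x
    refine ⟨?_, Finset.prod_congr rfl fun i _ => ?_⟩
    · rw [mem_baseGroup_iff]
      simp
    · rw [← hθ i (x.left ((x.right : Perm (Fin p)) i))⁻¹ (f ((x.right : Perm (Fin p)) i))]
      simp [wr_mul_left, wr_inv_left]

/-- The block permutation matrices that afford an induced character. -/
noncomputable def indMatrix {n : Type} [Fintype n] [DecidableEq n]
    (M : (Fin p → G) →* Matrix n n ℂ) : Wr p G →* Matrix (Cyc p × n) (Cyc p × n) ℂ := by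
  classical
  exact
  { toFun := fun w => Matrix.of fun a b => if w.right * b.1 = a.1 then
      M (fun i => w.left ((a.1 : Perm (Fin p)) i)) a.2 b.2 else 0
    map_one' := by
      ext a b
      have : (fun i => (1 : Wr p G).left ((a.1 : Perm (Fin p)) i)) = 1 := rfl
      rw [Matrix.of_apply, this, map_one, SemidirectProduct.one_right, one_mul, Matrix.one_apply,
        Matrix.one_apply]
      by_cases h1 : b.1 = a.1 <;> by_cases h2 : a.2 = b.2 <;>
        simp [h1, h2, Ne.symm, Prod.ext_iff, eq_comm (a := a.1)]
    map_mul' := fun x y => by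
      ext a b
      -- The block row `a.1` of `x` is nonzero only in the block column `x.right⁻¹ * a.1`.
      rw [Matrix.mul_apply, Fintype.sum_prod_type, Finset.sum_eq_single (x.right⁻¹ * a.1)]
      · simp only [Matrix.of_apply, mul_inv_cancel_left, if_true]
        have h1 : x.right * y.right * b.1 = a.1 ↔ y.right * b.1 = x.right⁻¹ * a.1 := by
          rw [eq_inv_mul_iff_mul_eq, mul_assoc]
        rw [wr_mul_right]
        by_cases h2 : y.right * b.1 = x.right⁻¹ * a.1
        · have h3 : (fun i => (x * y).left ((a.1 : Perm (Fin p)) i)) =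
              (fun i => x.left ((a.1 : Perm (Fin p)) i)) *
                fun i => y.left (((x.right⁻¹ * a.1 : Cyc p) : Perm (Fin p)) i) := by
            ext i
            rfl
          simp only [if_pos h2, if_pos (h1.2 h2), h3, map_mul, Matrix.mul_apply]
        · simp only [if_neg h2, if_neg (mt h1.1 h2), mul_zero, Finset.sum_const_zero]
      · intro c _ hc
        refine Finset.sum_eq_zero fun e _ => ?_
        rw [Matrix.of_apply, if_neg, zero_mul]
        intro h
        exact hc (by rw [← h, inv_mul_cancel_left])
      · simp }

omit [Fact p.Prime] in
theorem indMatrix_trace {n : Type} [Fintype n] [DecidableEq n]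
    (M : (Fin p → G) →* Matrix n n ℂ) (f : Fin p → G) :
    (indMatrix M (SemidirectProduct.inl f)).trace =
      ∑ δ : Cyc p, (M fun i => f ((δ : Perm (Fin p)) i)).trace := by
  rw [Matrix.trace, Fintype.sum_prod_type]
  refine Finset.sum_congr rfl fun δ _ => Finset.sum_congr rfl fun e _ => ?_
  simp [indMatrix]

omit [Fact p.Prime] in
theorem indMatrix_trace_of_right_ne_one {n : Type} [Fintype n] [DecidableEq n]
    (M : (Fin p → G) →* Matrix n n ℂ) {w : Wr p G} (hw : w.right ≠ 1) :
    (indMatrix M w).trace = 0 := by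
  refine Finset.sum_eq_zero fun a _ => ?_
  simp [indMatrix, hw]

/-- The tensor product of matrix representations. -/
noncomputable def prodMatrix {m : ℕ} {d : Fin m → ℕ}
    (M : ∀ i, G →* Matrix (Fin (d i)) (Fin (d i)) ℂ) :
    (Fin m → G) →* Matrix (∀ i, Fin (d i)) (∀ i, Fin (d i)) ℂ where
  toFun f := Matrix.of fun a b => ∏ i, M i (f i) (a i) (b i)
  map_one' := by
    ext a b
    simp only [Pi.one_apply, map_one, Matrix.of_apply, Matrix.one_apply]
    split_ifs with h
    · subst h; simp
    · obtain ⟨i, hi⟩ := Function.ne_iff.1 h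
      exact Finset.prod_eq_zero (Finset.mem_univ i) (if_neg hi)
  map_mul' f f' := by
    ext a b
    simp only [Pi.mul_apply, map_mul, Matrix.of_apply, Matrix.mul_apply, Finset.prod_univ_sum,
      Fintype.piFinset_univ, Finset.prod_mul_distrib]

theorem prodMatrix_trace {m : ℕ} {d : Fin m → ℕ}
    (M : ∀ i, G →* Matrix (Fin (d i)) (Fin (d i)) ℂ) (f : Fin m → G) :
    (prodMatrix M f).trace = ∏ i, (M i (f i)).trace := by
  simp only [Matrix.trace, Matrix.diag_apply, Finset.prod_univ_sum, Fintype.piFinset_univ]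
  rfl

/-- Reindexing of the base group by an element of the cyclic group. -/
def rotBase (G : Type) (δ : Cyc p) : (Fin p → G) ≃ (Fin p → G) :=
  Equiv.arrowCongr (δ : Perm (Fin p)).symm (Equiv.refl G)

omit [Fact p.Prime] in
theorem prod_comp_cyc (δ : Cyc p) (F : Fin p → ℂ) :
    ∏ i, F ((δ : Perm (Fin p)) i) = ∏ i, F i := Equiv.prod_comp _ F

theorem indProd_comp [Finite G] {θ : Fin p → G → ℂ} (hθ : ∀ i x g, θ i (x * g * x⁻¹) = θ i g)
    (c : Cyc p) : (indProd fun i => θ ((c : Perm (Fin p)) i)) = (indProd θ : Wr p G → ℂ) := by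
  ext w
  by_cases hw : w.right = 1
  · obtain ⟨f, rfl⟩ := (mem_baseGroup_iff w).2 hw
    rw [indProd_inl hθ, indProd_inl fun i => hθ _]
    rw [← Equiv.sum_comp (Equiv.mulRight c) fun δ : Cyc p =>
      ∏ i, θ ((c : Perm (Fin p)) i) (f ((δ : Perm (Fin p)) i))]
    refine Finset.sum_congr rfl fun δ _ => ?_
    rw [← prod_comp_cyc c fun i => θ i (f ((δ : Perm (Fin p)) i))]
    rfl
  · rw [indProd_of_right_ne_one _ hw, indProd_of_right_ne_one _ hw]

-- The restriction to the base group is the sum of the cyclic shifts of `θ_1 × ⋯ × θ_p`; the pairing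
-- counts the shifts of `ψ` equal to `θ`.
omit [Fact p.Prime] in
open Classical in
theorem sum_indProd_mul_prod [Fintype G] {θ ψ : Fin p → G → ℂ} (hθ : ∀ i, IsIrrChar (θ i))
    (hψ : ∀ i, IsIrrChar (ψ i)) :
    ∑ f : Fin p → G, indProd θ (SemidirectProduct.inl f : Wr p G) * ∏ i, ψ i (f i)⁻¹ =
      ∑ δ : Cyc p, if θ = fun i => ψ ((δ : Perm (Fin p)) i) then (Nat.card G : ℂ) ^ p else 0 := by
  simp_rw [indProd_inl fun i x g => (hθ i).conj x g, Finset.sum_mul]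
  rw [Finset.sum_comm]
  refine Finset.sum_congr rfl fun δ _ => ?_
  rw [← sum_prod_irr hθ fun i => hψ _, ← (rotBase G δ).sum_comp fun f : Fin p → G =>
    (∏ i, θ i (f i)) * ∏ i, ψ ((δ : Perm (Fin p)) i) (f i)⁻¹]
  refine Finset.sum_congr rfl fun f _ => ?_
  congr 1
  rw [← prod_comp_cyc δ]
  rfl

-- If no shift of `ψ` were `θ`, pairing the common induced character with `ψ` would give zero, yet
-- `δ = 1` contributes a positive term.
omit [Fact p.Prime] in
theorem exists_cyc_of_indProd_eq [Finite G] {θ ψ : Fin p → G → ℂ} (hθ : ∀ i, IsIrrChar (θ i))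
    (hψ : ∀ i, IsIrrChar (ψ i)) (h : (indProd θ : Wr p G → ℂ) = indProd ψ) :
    ∃ δ : Cyc p, ∀ i, θ i = ψ ((δ : Perm (Fin p)) i) := by
  classical
  have := Fintype.ofFinite G
  by_contra hcon
  push Not at hcon
  have h1 := sum_indProd_mul_prod hθ hψ
  rw [Finset.sum_eq_zero (s := Finset.univ) (f := fun δ : Cyc p =>
    if θ = fun i => ψ ((δ : Perm (Fin p)) i) then (Nat.card G : ℂ) ^ p else 0)
    fun δ _ => if_neg fun h2 => (hcon δ).elim fun i hi => hi (congrFun h2 i), h,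
    sum_indProd_mul_prod hψ hψ, ← Finset.sum_filter, Finset.sum_const, nsmul_eq_mul,
    mul_eq_zero] at h1
  rcases h1 with h1 | h1
  · rw [Nat.cast_eq_zero, Finset.card_eq_zero] at h1
    have : (1 : Cyc p) ∈ (∅ : Finset (Cyc p)) := by
      rw [← h1]
      simp
    simp at this
  · exact pow_ne_zero _ (Nat.cast_ne_zero.2 Nat.card_pos.ne') h1

theorem isIrrChar_indProd [Finite G] {θ : Fin p → G → ℂ} (hθ : ∀ i, IsIrrChar (θ i))
    (hne : ∃ i j, θ i ≠ θ j) : IsIrrChar (indProd θ : Wr p G → ℂ) := by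
  classical
  have := Fintype.ofFinite G
  have hcl : ∀ i x g, θ i (x * g * x⁻¹) = θ i g := fun i x g => (hθ i).conj x g
  choose d M hM using fun i => (hθ i).exists_matrix
  have htr : ∀ w : Wr p G, indProd θ w = (indMatrix (prodMatrix M) w).trace := by
    intro w
    by_cases hw : w.right = 1
    · obtain ⟨f, rfl⟩ := (mem_baseGroup_iff w).2 hw
      simp only [indProd_inl hcl, indMatrix_trace, prodMatrix_trace, hM]
    · rw [indProd_of_right_ne_one _ hw, indMatrix_trace_of_right_ne_one _ hw]
  -- A nontrivial shift is transitive, so a family fixed by it would be constant.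
  have hstab : ∀ δ : Cyc p, (θ = fun i => θ ((δ : Perm (Fin p)) i)) ↔ δ = 1 := by
    intro δ
    constructor
    · intro h
      by_contra hδ
      obtain ⟨i, j, hij⟩ := hne
      have h1 := eq_const_of_comp_cyc hδ fun i => (congrFun h i).symm
      exact hij ((h1 i).trans (h1 j).symm)
    · rintro rfl
      rfl
  rw [show (indProd θ : Wr p G → ℂ) = fun w => (indMatrix (prodMatrix M) w).trace from funext htr]
  apply isIrrChar_of_matrix
  simp only [← htr]
  rw [sum_wr_of_base _ fun w hw => by rw [indProd_of_right_ne_one _ hw, zero_mul]]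
  simp_rw [← map_inv, indProd_inl hcl (_⁻¹), Finset.mul_sum]
  rw [Finset.sum_comm]
  -- By `hstab`, exactly one shift matches for each `δ`. The `p` values of `δ` together give `p
  -- |G|^p`, the order of the wreath product.
  have hterm : ∀ δ : Cyc p, ∑ f : Fin p → G, indProd θ (SemidirectProduct.inl f : Wr p G) *
      ∏ i, θ i (f⁻¹ ((δ : Perm (Fin p)) i)) = (Nat.card G : ℂ) ^ p := by
    intro δ
    have h1 := sum_indProd_mul_prod hθ fun i => hθ (((δ⁻¹ : Cyc p) : Perm (Fin p)) i)
    have h2 : ∀ f : Fin p → G, ∏ i, θ i (f⁻¹ ((δ : Perm (Fin p)) i)) =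
        ∏ i, θ (((δ⁻¹ : Cyc p) : Perm (Fin p)) i) (f i)⁻¹ := by
      intro f
      rw [← prod_comp_cyc δ fun i => θ (((δ⁻¹ : Cyc p) : Perm (Fin p)) i) (f i)⁻¹]
      simp
    simp_rw [h2, h1]
    rw [Finset.sum_eq_single δ]
    · rw [if_pos]
      ext i
      simp
    · intro c _ hc
      rw [if_neg]
      intro h3
      have h4 := (hstab (δ⁻¹ * c)).1 (h3.trans rfl)
      exact hc (inv_mul_eq_one.1 h4).symm
    · simp
  rw [Finset.sum_congr rfl fun δ _ => hterm δ, Finset.sum_const, Finset.card_univ,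
    ← Nat.card_eq_fintype_card, card_cyc, card_wr, nsmul_eq_mul]
  push_cast
  ring

/-- At the rotation one side is `φ(1) ω^ε ≠ 0` and the other vanishes. -/
theorem ext_ne_indProd [Finite G] {φ : G → ℂ} (hφ : IsIrrChar φ) (ε : Fin p) (θ : Fin p → G → ℂ) :
    (fun w : Wr p G => extVal φ w * phi p ε w.right) ≠ indProd θ := by
  intro h
  have h1 := congrFun h (SemidirectProduct.inr (rot p))
  rw [indProd_of_right_ne_one _ (by exact rot_ne_one), hφ.extVal_rot] at h1
  obtain ⟨d, hd, hd1⟩ := hφ.exists_degree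
  rw [hd1] at h1
  exact mul_ne_zero (Nat.cast_ne_zero.2 hd.ne') (phi_ne_zero _ _) h1

/-- The irreducible characters of the wreath product. -/
theorem IsIrrChar.ext_or_indProd [Finite G] {χ : Wr p G → ℂ} (hχ : IsIrrChar χ) :
    (∃ (φ : G → ℂ) (ε : Fin p), IsIrrChar φ ∧ χ = fun w => extVal φ w * phi p ε w.right) ∨
      ∃ θ : Fin p → G → ℂ, (∀ i, IsIrrChar (θ i)) ∧ (∃ i j, θ i ≠ θ j) ∧ χ = indProd θ := by
  have := Fintype.ofFinite G
  have hp0 : (p : ℂ) ≠ 0 := Nat.cast_ne_zero.2 (Fact.out : p.Prime).ne_zero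
  -- Some product character occurs in the restriction to the base group; otherwise `χ` would vanish
  -- there, although its degree is positive.
  obtain ⟨ψ, hψ, hne⟩ : ∃ ψ : Fin p → G → ℂ, (∀ i, IsIrrChar (ψ i)) ∧
      ∑ f : Fin p → G, χ (SemidirectProduct.inl f) * ∏ i, ψ i (f i)⁻¹ ≠ 0 := by
    by_contra! hcon
    have h1 := eq_zero_of_orthogonal_prod (F := fun f : Fin p → G => χ (SemidirectProduct.inl f))
      (fun x g => by rw [map_mul, map_mul, map_inv]; exact hχ.conj _ _) hcon
    obtain ⟨d, hd, hd1⟩ := hχ.exists_degree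
    have h2 := congrFun h1 1
    rw [map_one, hd1] at h2
    exact hd.ne' (Nat.cast_eq_zero.1 h2)
  by_cases hconst : ∀ i, ψ i = ψ (firstLetter p)
  · left
    by_contra! hcon
    -- If `χ` were none of the `p` extensions, it would be orthogonal to their sum. Since the `φ_ε`
    -- sum to zero off the identity, that pairing is `p` times the nonzero pairing over the base
    -- group.
    have h1 : ∀ ε : Fin p, ∑ w : Wr p G, χ w *
        (extVal (ψ (firstLetter p)) w⁻¹ * phi p ε (w⁻¹).right) = 0 := fun ε =>
      hχ.sum_mul_inv_of_ne ((hψ _).ext ε) (hcon _ ε (hψ _))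
    have h2 := Finset.sum_eq_zero fun ε (_ : ε ∈ Finset.univ) => h1 ε
    rw [Finset.sum_comm] at h2
    simp_rw [← Finset.mul_sum] at h2
    rw [sum_wr_of_base _ fun w hw => by
      rw [sum_phi (by rw [wr_inv_right]; exact inv_ne_one.2 hw), mul_zero, mul_zero]] at h2
    simp_rw [← map_inv, SemidirectProduct.right_inl, sum_phi_one, extVal_inl, ← mul_assoc,
      ← Finset.sum_mul] at h2
    apply hne
    simp_rw [hconst]
    exact (mul_eq_zero.1 h2).resolve_right hp0
  · right
    push Not at hconst
    obtain ⟨i, hi⟩ := hconst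
    refine ⟨ψ, hψ, ⟨i, _, hi⟩, ?_⟩
    by_contra hcon
    have h1 := hχ.sum_mul_inv_of_ne (isIrrChar_indProd hψ ⟨i, _, hi⟩) hcon
    rw [sum_wr_of_base _ fun w hw => by
      rw [indProd_of_right_ne_one _ (by rw [wr_inv_right]; exact inv_ne_one.2 hw), mul_zero]] at h1
    simp_rw [← map_inv, indProd_inl fun i x g => (hψ i).conj x g, Finset.mul_sum] at h1
    rw [Finset.sum_comm] at h1
    -- Frobenius reciprocity by hand: `χ` is invariant under conjugation by the top group, so every
    -- shift of `ψ` pairs equally with it.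
    have h2 : ∀ δ : Cyc p, ∑ f : Fin p → G, χ (SemidirectProduct.inl f) *
        ∏ i, ψ i (f⁻¹ ((δ : Perm (Fin p)) i)) =
        ∑ f : Fin p → G, χ (SemidirectProduct.inl f) * ∏ i, ψ i (f i)⁻¹ := by
      intro δ
      rw [← (rotBase G δ).sum_comp fun f => χ (SemidirectProduct.inl f) * ∏ i, ψ i (f i)⁻¹]
      refine Finset.sum_congr rfl fun f _ => ?_
      congr 1
      rw [← hχ.conj (SemidirectProduct.inr δ⁻¹), inr_mul_inl_mul_inv]
      congr 2
    rw [Finset.sum_congr rfl fun δ _ => h2 δ, Finset.sum_const, Finset.card_univ,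
      ← Nat.card_eq_fintype_card, card_cyc, nsmul_eq_mul] at h1
    exact hne ((mul_eq_zero.1 h1).resolve_left hp0)

end Induced

/-! ### Tree functions -/

section Trees

variable {p k : ℕ}

/-- The twist at the empty sequence permutes the subtrees, and the remaining twists act
independently inside them. This turns equivalence into a recursion matching that of `treeOf`. -/
theorem labEquiv_succ_iff {t t' : Labelling p (k + 1)} :
    LabEquiv t t' ↔ t (root p k) = t' (root p k) ∧
      ∃ γ : Cyc p, ∀ i, LabEquiv (sub t i) (sub t' ((γ : Perm (Fin p)) i)) := by
  constructor
  · rintro ⟨γ, hγ, h⟩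
    exact ⟨h (root p k), ⟨γ [], hγ []⟩, fun i =>
      ⟨fun q => γ (i :: q), fun q => hγ _, fun s => h ⟨i :: s.1, by simpa using s.2⟩⟩⟩
  · rintro ⟨h0, γ, h⟩
    choose Γ hΓ hs using h
    refine ⟨fun q => match q with
      | [] => γ
      | i :: q => Γ i q, fun q => ?_, ?_⟩
    · match q with
      | [] => exact γ.2
      | i :: q => exact hΓ i q
    · rintro ⟨s, hlen⟩
      match s, hlen with
      | [], _ => exact h0
      | i :: s, hlen => exact hs i ⟨s, by simpa using hlen⟩

theorem mk_eq_mk_iff {t t' : Labelling p k} : (⟦t⟧ : TreeFun p k) = ⟦t'⟧ ↔ LabEquiv t t' :=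
  Quotient.eq

theorem sub_join (f : Fin p → Labelling p k) (x : Fin (p + 1)) (i : Fin p) :
    sub (join f x) i = f i := rfl

theorem mk_eq_treeJoin_iff {t : Labelling p (k + 1)} {F : Fin p → TreeFun p k}
    {x : Fin (p + 1)} : (⟦t⟧ : TreeFun p (k + 1)) = treeJoin F x ↔ t (root p k) = x ∧
      ∃ γ : Cyc p, ∀ i, (⟦sub t i⟧ : TreeFun p k) = F ((γ : Perm (Fin p)) i) := by
  have h : ∀ (i : Fin p) (γ : Cyc p), LabEquiv (sub t i)
      (sub (join (fun i => (F i).out) x) ((γ : Perm (Fin p)) i)) ↔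
      (⟦sub t i⟧ : TreeFun p k) = F ((γ : Perm (Fin p)) i) := by
    intro i γ
    rw [sub_join, ← mk_eq_mk_iff, Quotient.out_eq]
  rw [treeJoin, mk_eq_mk_iff, labEquiv_succ_iff]
  simp only [h]
  rfl

theorem treeJoin_comp_cyc (F : Fin p → TreeFun p k) (x : Fin (p + 1)) (δ : Cyc p) :
    treeJoin (fun i => F ((δ : Perm (Fin p)) i)) x = treeJoin F x := by
  obtain ⟨t, ht⟩ := Quotient.exists_rep (treeJoin (fun i => F ((δ : Perm (Fin p)) i)) x)
  rw [← ht]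
  obtain ⟨h0, γ, h⟩ := mk_eq_treeJoin_iff.1 ht
  exact mk_eq_treeJoin_iff.2 ⟨h0, δ * γ, h⟩

theorem treeJoin_eq_treeJoin {F F' : Fin p → TreeFun p k} {x x' : Fin (p + 1)}
    (h : treeJoin F x = treeJoin F' x') :
    x = x' ∧ ∃ γ : Cyc p, ∀ i, F i = F' ((γ : Perm (Fin p)) i) := by
  obtain ⟨t, ht⟩ := Quotient.exists_rep (treeJoin F x)
  obtain ⟨h0, γ, h1⟩ := mk_eq_treeJoin_iff.1 ht
  obtain ⟨h0', γ', h1'⟩ := mk_eq_treeJoin_iff.1 (ht.trans h)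
  refine ⟨h0.symm.trans h0', γ' * γ⁻¹, fun i => ?_⟩
  have h2 := h1 (((γ⁻¹ : Cyc p) : Perm (Fin p)) i)
  rw [h1'] at h2
  simpa using h2.symm

instance : IsEmpty (Skel p 0) := ⟨fun s => Nat.not_lt_zero _ s.2⟩

instance : Subsingleton (TreeFun p 0) :=
  ⟨fun a b => Quotient.inductionOn₂ a b fun t t' => by rw [Subsingleton.elim t t']⟩

theorem isAdmissible_succ {t : Labelling p (k + 1)} (hsub : ∀ i, IsAdmissible k (sub t i))
    (hne : t (root p k) ≠ Fin.last p → ∀ i j, (⟦sub t i⟧ : TreeFun p k) = ⟦sub t j⟧)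
    (hlast : t (root p k) = Fin.last p → ∃ i j, (⟦sub t i⟧ : TreeFun p k) ≠ ⟦sub t j⟧) :
    IsAdmissible (k + 1) t := by
  cases k with
  | zero =>
    -- For a leaf, the subtrees lie in a one-element type, so the condition attached to the label
    -- `p` cannot hold.
    intro h
    obtain ⟨i, j, hij⟩ := hlast h
    exact hij (Subsingleton.elim _ _)
  | succ k => exact ⟨hsub, hne, hlast⟩

end Trees

/-! ### The tree function of an irreducible character -/

section TreeOf

variable {p : ℕ} [Fact p.Prime]

theorem IsIrrChar.comp_mulEquiv {H G : Type} [Group H] [Group G] {χ : G → ℂ} (h : IsIrrChar χ)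
    (e : H ≃* G) : IsIrrChar fun x => χ (e x) := by
  obtain ⟨V, _, _, _, ρ, hρ, rfl⟩ := h
  refine ⟨V, _, _, inferInstance, ρ.comp e.toMonoidHom, ?_, rfl⟩
  apply isIrreducible_of_comp _ e.symm.toMonoidHom
  have : (ρ.comp e.toMonoidHom).comp e.symm.toMonoidHom = ρ := by
    ext g : 1
    simp
  rw [this]
  exact hρ

instance : Subsingleton (P p 0) := by
  have : Subsingleton (Fin (p ^ 0)) := by rw [pow_zero]; infer_instance
  infer_instance

theorem IsIrrChar.eq_one_of_subsingleton {G : Type} [Group G] [Subsingleton G] {χ : G → ℂ}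
    (h : IsIrrChar χ) : χ = 1 := by
  have := Fintype.ofFinite G
  have h1 := h.sum_mul_inv_self
  obtain ⟨d, hd, hd1⟩ := h.exists_degree
  have h2 : d * d = 1 := by
    rw [Fintype.sum_subsingleton _ 1, inv_one, hd1, Nat.card_unique] at h1
    exact_mod_cast h1
  ext g
  rw [Subsingleton.elim g 1, hd1, Nat.eq_one_of_mul_eq_one_left h2]
  simp

variable {k : ℕ} {θ θ' : P p (k + 1) → ℂ}

theorem caseExt_iff {d : (P p k → ℂ) × Fin p} : CaseExt θ d ↔ IsIrrChar d.1 ∧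
    (fun w => θ (wrIso p k w)) = fun w => extVal d.1 w * phi p d.2 w.right :=
  and_congr_right fun h => isExtChar_iff h _ _

theorem CaseExt.unique {d d' : (P p k → ℂ) × Fin p} (h : CaseExt θ d) (h' : CaseExt θ d') :
    d = d' := by
  rw [caseExt_iff] at h h'
  exact Prod.ext_iff.2 (ext_injective h.1 h'.1 (congrFun (h.2.symm.trans h'.2)))

theorem CaseInd.not_caseExt {d : Fin p → P p k → ℂ} (h : CaseInd θ d) :
    ¬ ∃ d', CaseExt θ d' := by
  rintro ⟨d', h'⟩
  rw [caseExt_iff] at h'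
  exact ext_ne_indProd h'.1 _ _ (h'.2.symm.trans h.2.2)

theorem CaseInd.exists_cyc {d d' : Fin p → P p k → ℂ} (h : CaseInd θ d) (h' : CaseInd θ d') :
    ∃ δ : Cyc p, ∀ i, d i = d' ((δ : Perm (Fin p)) i) :=
  exists_cyc_of_indProd_eq h.1 h'.1 (h.2.2.symm.trans h'.2.2)

theorem caseExt_or_caseInd (hθ : IsIrrChar θ) : (∃ d, CaseExt θ d) ∨ ∃ d, CaseInd θ d := by
  rcases (hθ.comp_mulEquiv (wrIso p k)).ext_or_indProd with ⟨φ, ε, hφ, h⟩ | ⟨ψ, hψ, hne, h⟩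
  · exact Or.inl ⟨(φ, ε), caseExt_iff.2 ⟨hφ, h⟩⟩
  · exact Or.inr ⟨ψ, hψ, hne, h⟩

theorem CaseExt.treeOf_eq {d : (P p k → ℂ) × Fin p} (h : CaseExt θ d) :
    treeOf (k + 1) θ = treeJoin (fun _ => treeOf k d.1) d.2.castSucc := by
  have hex : ∃ d, CaseExt θ d := ⟨d, h⟩
  rw [treeOf, dif_pos hex, hex.choose_spec.unique h]

theorem CaseInd.treeOf_eq {d : Fin p → P p k → ℂ} (h : CaseInd θ d) :
    treeOf (k + 1) θ = treeJoin (fun i => treeOf k (d i)) (Fin.last p) := by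
  have hex : ∃ d, CaseInd θ d := ⟨d, h⟩
  rw [treeOf, dif_neg h.not_caseExt, dif_pos hex]
  -- The family picked by choice may differ from `d` by a cyclic shift, which `treeJoin` ignores.
  obtain ⟨δ, hδ⟩ := hex.choose_spec.exists_cyc h
  rw [← treeJoin_comp_cyc (fun i => treeOf k (d i)) _ δ]
  simp only [hδ]

theorem CaseExt.isIrrChar {d : (P p k → ℂ) × Fin p} (h : CaseExt θ d) : IsIrrChar θ := by
  rw [caseExt_iff] at h
  have := h.1.ext d.2
  rw [← h.2] at this
  simpa using this.comp_mulEquiv (wrIso p k).symm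

theorem CaseInd.isIrrChar {d : Fin p → P p k → ℂ} (h : CaseInd θ d) : IsIrrChar θ := by
  have := (isIrrChar_indProd h.1 h.2.1).comp_mulEquiv (wrIso p k).symm
  rw [← h.2.2] at this
  simpa using this

theorem wrIso_comp_injective (h : (fun w => θ (wrIso p k w)) = fun w => θ' (wrIso p k w)) :
    θ = θ' := by
  ext g
  simpa using congrFun h ((wrIso p k).symm g)

/-- An irreducible character is determined by its tree function. -/
theorem treeOf_injective (k : ℕ) {θ θ' : P p k → ℂ} (hθ : IsIrrChar θ) (hθ' : IsIrrChar θ')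
    (h : treeOf k θ = treeOf k θ') : θ = θ' := by
  induction k with
  | zero => rw [hθ.eq_one_of_subsingleton, hθ'.eq_one_of_subsingleton]
  | succ k ih =>
    apply wrIso_comp_injective
    rcases caseExt_or_caseInd hθ with ⟨d, hd⟩ | ⟨d, hd⟩ <;>
      rcases caseExt_or_caseInd hθ' with ⟨d', hd'⟩ | ⟨d', hd'⟩ <;>
      rw [hd.treeOf_eq, hd'.treeOf_eq] at h <;>
      obtain ⟨hx, γ, hF⟩ := treeJoin_eq_treeJoin h
    · rw [(caseExt_iff.1 hd).2, (caseExt_iff.1 hd').2, ih hd.1 hd'.1 (hF (firstLetter p)),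
        Fin.castSucc_injective p hx]
    · exact absurd hx (Fin.castSucc_ne_last _)
    · exact absurd hx.symm (Fin.castSucc_ne_last _)
    · have hdd : d = fun i => d' ((γ : Perm (Fin p)) i) :=
        funext fun i => ih (hd.1 i) (hd'.1 _) (hF i)
      rw [hd.2.2, hd'.2.2, hdd, indProd_comp fun i x g => (hd'.1 i).conj x g]

end TreeOf

/-! ### Galois conjugation -/

section Galois

variable {p : ℕ} (σ : CycField p ≃ₐ[ℚ] CycField p)

/-- `z'` is the image under `σ` of the element `z` of `ℚ(ω)`. -/
def GalRel (z z' : ℂ) : Prop := ∃ y : CycField p, (y : ℂ) = z ∧ ((σ y : CycField p) : ℂ) = z'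

variable {σ}

theorem GalRel.one : GalRel σ 1 1 := ⟨1, by simp⟩

theorem GalRel.mul {a a' b b' : ℂ} (ha : GalRel σ a a') (hb : GalRel σ b b') :
    GalRel σ (a * b) (a' * b') := by
  obtain ⟨x, rfl, rfl⟩ := ha
  obtain ⟨y, rfl, rfl⟩ := hb
  exact ⟨x * y, by simp⟩

theorem GalRel.pow {a a' : ℂ} (ha : GalRel σ a a') (n : ℕ) : GalRel σ (a ^ n) (a' ^ n) := by
  obtain ⟨x, rfl, rfl⟩ := ha
  exact ⟨x ^ n, by simp⟩

theorem GalRel.prod {ι : Type*} {s : Finset ι} {a a' : ι → ℂ} (h : ∀ i, GalRel σ (a i) (a' i)) :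
    GalRel σ (∏ i ∈ s, a i) (∏ i ∈ s, a' i) := by
  choose y hy hy' using h
  refine ⟨∏ i ∈ s, y i, ?_, ?_⟩
  · simp only [← hy]
    exact map_prod (algebraMap (CycField p) ℂ) _ _
  · rw [map_prod]
    simp only [← hy']
    exact map_prod (algebraMap (CycField p) ℂ) _ _

theorem GalRel.sum {ι : Type*} {s : Finset ι} {a a' : ι → ℂ} (h : ∀ i, GalRel σ (a i) (a' i)) :
    GalRel σ (∑ i ∈ s, a i) (∑ i ∈ s, a' i) := by
  choose y hy hy' using h
  refine ⟨∑ i ∈ s, y i, ?_, ?_⟩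
  · simp only [← hy]
    exact map_sum (algebraMap (CycField p) ℂ) _ _
  · rw [map_sum]
    simp only [← hy']
    exact map_sum (algebraMap (CycField p) ℂ) _ _

theorem GalRel.zero : GalRel σ 0 0 := ⟨0, by simp⟩

/-- Injectivity of `σ`; it keeps the conjugates of distinct characters distinct. -/
theorem GalRel.left_unique {a b c : ℂ} (ha : GalRel σ a c) (hb : GalRel σ b c) : a = b := by
  obtain ⟨x, rfl, rfl⟩ := ha
  obtain ⟨y, rfl, h⟩ := hb
  rw [σ.injective (Subtype.ext h)]

theorem GalRel.mem {a a' : ℂ} (h : GalRel σ a a') : a ∈ CycField p := by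
  obtain ⟨x, rfl, -⟩ := h
  exact x.2

/-- The relation includes membership in `ℚ(ω)`, so the default value `0` in `galConj` never occurs.
-/
theorem galConj_eq {G : Type} {θ θ' : G → ℂ} (h : ∀ g, GalRel σ (θ g) (θ' g)) :
    galConj σ θ = θ' := by
  ext g
  obtain ⟨x, hx, hx'⟩ := h g
  rw [galConj, dif_pos (h g).mem]
  refine Eq.trans ?_ hx'
  congr 2
  exact Subtype.ext hx.symm

variable [Fact p.Prime] {G : Type} [Group G] {b : ℕ}

theorem GalRel.extVal {φ φ' : G → ℂ} (h : ∀ g, GalRel σ (φ g) (φ' g)) (w : Wr p G) :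
    GalRel σ (extVal φ w) (extVal φ' w) := by
  unfold SylowTree.extVal
  split_ifs
  · exact .prod fun i => h _
  · exact h _

theorem GalRel.indProd [Finite G] {ψ ψ' : Fin p → G → ℂ}
    (hψ : ∀ i x g, ψ i (x * g * x⁻¹) = ψ i g) (hψ' : ∀ i x g, ψ' i (x * g * x⁻¹) = ψ' i g)
    (h : ∀ i g, GalRel σ (ψ i g) (ψ' i g)) (w : Wr p G) :
    GalRel σ (indProd ψ w) (indProd ψ' w) := by
  by_cases hw : w.right = 1
  · obtain ⟨f, rfl⟩ := (mem_baseGroup_iff w).2 hw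
    rw [indProd_inl hψ, indProd_inl hψ']
    exact .sum fun δ => .prod fun i => h _ _
  · rw [indProd_of_right_ne_one _ hw, indProd_of_right_ne_one _ hw]
    exact .zero

/-- Multiplication of the index of `φ_ε` by `b`. -/
def mulIndex (b : ℕ) (ε : Fin p) : Fin p := ⟨b * ε % p, Nat.mod_lt _ (Fact.out : p.Prime).pos⟩

theorem tau_castSucc (ε : Fin p) : tau p b ε.castSucc = (mulIndex b ε).castSucc := by
  rw [tau, if_neg (Fin.castSucc_ne_last ε)]
  apply Fin.ext
  -- `Fin.ofNat` reduces modulo `p + 1`, which leaves a residue modulo `p` unchanged.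
  have : b * (ε : ℕ) % p < p + 1 :=
    (Nat.mod_lt _ (Fact.out : p.Prime).pos).trans (Nat.lt_succ_self p)
  simp [mulIndex, Nat.mod_eq_of_lt this]

omit [Fact p.Prime] in
theorem tau_last : tau p b (Fin.last p) = Fin.last p := if_pos rfl

theorem GalRel.phi (hσb : σ (AdjoinSimple.gen ℚ (zetaP p)) = AdjoinSimple.gen ℚ (zetaP p) ^ b)
    (ε : Fin p) (δ : Cyc p) : GalRel σ (phi p ε δ) (phi p (mulIndex b ε) δ) := by
  have h1 : GalRel σ (zetaP p) (zetaP p ^ b) :=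
    ⟨AdjoinSimple.gen ℚ (zetaP p), AdjoinSimple.coe_gen ℚ (zetaP p), by rw [hσb]; simp⟩
  have h2 := (h1.pow ε).pow ((δ : Perm (Fin p)) (firstLetter p))
  rw [phi_eq, phi_eq, pow_mul, pow_mul, mulIndex]
  dsimp only
  rw [zetaP_pow_mod, pow_mul]
  exact h2

/-- All claims go through one induction, as irreducibility of the conjugate comes from the form it
is built in. Quantifying over every representative `t` lets the induction hypothesis apply to the
subtrees of an arbitrary labelling. -/
theorem exists_galRel_treeOf
    (hσb : σ (AdjoinSimple.gen ℚ (zetaP p)) = AdjoinSimple.gen ℚ (zetaP p) ^ b) (k : ℕ)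
    {θ : P p k → ℂ} (hθ : IsIrrChar θ) :
    ∃ θ' : P p k → ℂ, (∀ g, GalRel σ (θ g) (θ' g)) ∧ IsIrrChar θ' ∧
      ∀ t : Labelling p k, (⟦t⟧ : TreeFun p k) = treeOf k θ →
        IsAdmissible k t ∧ treeOf k θ' = ⟦fun s => tau p b (t s)⟧ := by
  induction k with
  | zero =>
    refine ⟨θ, fun g => ?_, hθ, fun t _ => ⟨trivial, Subsingleton.elim _ _⟩⟩
    rw [hθ.eq_one_of_subsingleton]
    exact .one
  | succ k ih =>
    rcases caseExt_or_caseInd hθ with ⟨⟨φ, ε⟩, hd⟩ | ⟨ψ, hd⟩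
    · obtain ⟨φ', hrel, hφ', htree⟩ := ih hd.1
      let θ' : P p (k + 1) → ℂ := fun g => extVal φ' ((wrIso p k).symm g) *
        SylowTree.phi p (mulIndex b ε) ((wrIso p k).symm g).right
      have hd' : CaseExt θ' (φ', mulIndex b ε) := by
        rw [caseExt_iff]
        exact ⟨hφ', by simp [θ']⟩
      refine ⟨θ', fun g => ?_, hd'.isIrrChar, fun t ht => ?_⟩
      · have h1 := congrFun (caseExt_iff.1 hd).2 ((wrIso p k).symm g)
        simp only [MulEquiv.apply_symm_apply] at h1
        rw [h1]
        exact (GalRel.extVal hrel _).mul (GalRel.phi hσb _ _)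
      · rw [hd.treeOf_eq] at ht
        obtain ⟨h0, γ, hsub⟩ := mk_eq_treeJoin_iff.1 ht
        refine ⟨isAdmissible_succ (fun i => (htree _ (hsub i)).1)
          (fun _ i j => (hsub i).trans (hsub j).symm)
          (fun h => absurd (h0.symm.trans h) (Fin.castSucc_ne_last _)), ?_⟩
        rw [hd'.treeOf_eq]
        -- All subtrees represent the same tree function, so the identity rotation suffices.
        refine (mk_eq_treeJoin_iff.2 ⟨?_, 1, fun i => (htree _ (hsub i)).2.symm⟩).symm
        dsimp only
        rw [h0, tau_castSucc]
    · choose ψ' hrel hψ' htree using fun i => ih (hd.1 i)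
      let θ' : P p (k + 1) → ℂ := fun g => SylowTree.indProd ψ' ((wrIso p k).symm g)
      obtain ⟨i₀, j₀, hne⟩ := hd.2.1
      have hd' : CaseInd θ' ψ' := by
        refine ⟨hψ', ⟨i₀, j₀, fun h => hne (funext fun g => (hrel i₀ g).left_unique ?_)⟩,
          by simp [θ']⟩
        rw [h]
        exact hrel j₀ g
      refine ⟨θ', fun g => ?_, hd'.isIrrChar, fun t ht => ?_⟩
      · have h1 := congrFun hd.2.2 ((wrIso p k).symm g)
        simp only [MulEquiv.apply_symm_apply] at h1
        rw [h1]
        exact GalRel.indProd (fun i x g => (hd.1 i).conj x g) (fun i x g => (hψ' i).conj x g)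
          hrel _
      · rw [hd.treeOf_eq] at ht
        obtain ⟨h0, γ, hsub⟩ := mk_eq_treeJoin_iff.1 ht
        refine ⟨isAdmissible_succ (fun i => (htree _ _ (hsub i)).1)
          (fun h => absurd h0 h) (fun _ => ?_), ?_⟩
        · refine ⟨((γ⁻¹ : Cyc p) : Perm (Fin p)) i₀, ((γ⁻¹ : Cyc p) : Perm (Fin p)) j₀, ?_⟩
          rw [hsub, hsub]
          intro h
          have h1 := treeOf_injective k (hd.1 _) (hd.1 _) h
          exact hne (by simpa using h1)
        · rw [hd'.treeOf_eq]
          -- Conjugation keeps the order of the constituents, so the rotation that matches `t` to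
          -- `θ` also serves for `θ'`.
          refine (mk_eq_treeJoin_iff.2 ⟨?_, γ, fun i => (htree _ _ (hsub i)).2.symm⟩).symm
          rw [h0, tau_last]

end Galois

end SylowTree

open SylowTree
theorem theorem3 (p : ℕ) [Fact p.Prime]
    (σ : CycField p ≃ₐ[ℚ] CycField p) (hσ : Subgroup.zpowers σ = ⊤)
    (b : ℕ) (hb : 1 ≤ b ∧ b ≤ p - 1)
    (hσb : σ (IntermediateField.AdjoinSimple.gen ℚ (zetaP p)) =
      IntermediateField.AdjoinSimple.gen ℚ (zetaP p) ^ b)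
    (k : ℕ) (hk : 1 ≤ k) (θ : P p k → ℂ) (hθ : IsIrrChar θ) :
    (∀ g, θ g ∈ CycField p) ∧
    IsIrrChar (galConj σ θ) ∧
    ∀ t : Labelling p k, (⟦t⟧ : TreeFun p k) = treeOf k θ →
      IsAdmissible k t ∧
      treeOf k (galConj σ θ) = ⟦fun s => tau p b (t s)⟧ := by
  obtain ⟨θ', hrel, hθ', htree⟩ := exists_galRel_treeOf hσb k hθ
  rw [galConj_eq hrel]
  exact ⟨fun g => (hrel g).mem, hθ', htree⟩
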